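/- Let $M$ be a smooth manifold (Hausdorff, second countable) with generalized tangent bundle $\mathbb{T}M=TM\oplus T^*M$, equipped with the tautological inner product $\langle X+\alpha,Y+\beta\rangle=\tfrac12(\alpha(Y)+\beta(X))$ and with the Dorfman bracket $[\![X+\alpha,Y+\beta]\!]=[X,Y]+L_X\beta-\iota_Y d\alpha$ on its smooth sections. Sections $\mathbf{x}=X+\alpha$ of $\mathbb{T}M$ act on the space $\Omega_M$ of differential forms as $\iota_X+\alpha\wedge$, and are identified with these operators. Let $[\cdot,\cdot]$ denote the graded commutator on the graded algebra $\mathrm{End}_{\mathbb R}(\Omega_M)$, and for $\delta\in \mathrm{End}_{\mathbb R}(\Omega_M)$ let $[\![\mathbf{x},\mathbf{y}]\!]_\delta=[[\mathbf{x},\delta],\mathbf{y}]$ be the derived bracket. Let $\varphi$ be a smooth bundle endomorphism of $\mathbb{T}M$ that is skew-symmetric, i.e. $\langle\varphi\mathbf{x},\mathbf{y}\rangle+\langle\mathbf{x},\varphi\mathbf{y}\rangle=0$. * $\varphi$ is a *generalized polynomial structure* if there is a monic real polynomial $P$ of positive degree that is the minimal polynomial of $\varphi_p\in\mathrm{End}(T_pM\oplus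 T_p^*M)$ for every $p\in M$. * The *minimal polynomial* of $\varphi$, when it exists, is the monic real polynomial $P$ of least degree with $P(\varphi)=0$ (for a generalized polynomial structure on non-empty $M$ it is the common minimal polynomial of the $\varphi_p$). * The *lift* $\widetilde\varphi$ of $\varphi$ is the unique even operator on $\Omega_M$ with $[\widetilde\varphi,f]=0$ for all smooth functions $f$, $[\widetilde\varphi,\mathbf{x}]=\varphi(\mathbf{x})$ for all sections $\mathbf{x}$ of $\mathbb{T}M$, and $\widetilde\varphi(1)\in\Omega^2$. * If $\varphi$ has minimal polynomial $P$, it is *minimal* if $[\![\mathbf{x},\mathbf{y}]\!]_{\delta_\varphi}=0$ for all sections $\mathbf{x},\mathbf{y}$ of $\mathbb{T}M$, where $\delta_\varphi=P(\mathrm{ad}_{\widetilde\varphi})(d)$. * The *Courant–Nijenhuis torsion* of $\varphi$ is $\mathcal T_\varphi(\mathbf{x},\mathbf{y})=\varphi^2[\![\mathbf{x},\mathbf{y}]\!]+[\![\varphi\mathbf{x},\varphi\mathbf{y}]\!]-\varphi\big([\![\varphi\mathbf{x},\mathbf{y}]\!]+[\![\mathbf{x},\varphi\mathbf{y}]\!]\big)$,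 and the *bivariate Courant–Nijenhuis torsion* of commuting $\varphi',\varphi''$ is $\mathcal T_{\varphi'+\varphi''}-\mathcal T_{\varphi'}-\mathcal T_{\varphi''}$. **Proposition.** Let $\varphi'$ and $\varphi''$ be generalized polynomial structures on $M$ and let $\varphi=\varphi'+\varphi''$. Let $P$ be the minimal polynomial of $\varphi$. Suppose that 1. $\varphi'\circ\varphi''=0=\varphi''\circ\varphi'$; 2. $\varphi'$ and $\varphi''$ are both minimal; 3. $P(\varphi')=0$ and $P(\varphi'')=0$; 4. the bivariate Courant–Nijenhuis torsion of $\varphi'$ and $\varphi''$ vanishes. Then $\varphi$ is minimal. -/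

import Mathlib

open scoped Manifold ContDiff Bundle
open VectorField Bundle

namespace GenPoly

/-- The model space `ℝⁿ`. -/
abbrev Model (n : ℕ) : Type := EuclideanSpace ℝ (Fin n)

section
variable (n : ℕ) (M : Type*) [TopologicalSpace M] [ChartedSpace (Model n) M]

/-- The ring `C^∞(M) = Ω⁰` of smooth real functions. -/
abbrev Fn : Type _ := C^∞⟮𝓡 n, M; 𝓘(ℝ, ℝ), ℝ⟯

variable [IsManifold (𝓡 n) ∞ M]

/-- Vector fields: the smooth sections of the tangent bundle. -/
abbrev VF : Type _ := Cₛ^∞⟮𝓡 n; Model n, (TangentSpace (𝓡 n) : M → Type _)⟯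

end

section
variable {n : ℕ} {M : Type*} [TopologicalSpace M] [ChartedSpace (Model n) M]
  [IsManifold (𝓡 n) ∞ M]


noncomputable instance : SMul (Fn n M) (VF n M) :=
  ⟨fun f X => ⟨fun p => f p • X p, f.contMDiff.smul_section X.contMDiff⟩⟩

@[simp] theorem VF.smul_apply (f : Fn n M) (X : VF n M) (p : M) : (f • X) p = f p • X p := rfl

noncomputable instance : Module (Fn n M) (VF n M) where
  one_smul X := by ext p : 1; simp
  mul_smul f g X := by ext p : 1; simp [mul_smul]
  smul_zero f := by ext p : 1; simp
  smul_add f X Y := by ext p : 1; simp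
  add_smul f g X := by ext p : 1; simp [add_smul]
  zero_smul X := by ext p : 1; simp

instance : IsScalarTower ℝ (Fn n M) (VF n M) where
  smul_assoc c f X := by ext p : 1; simp [mul_smul]

theorem Fn.mdiff {n : ℕ} {M : Type*} [TopologicalSpace M] [ChartedSpace (Model n) M] (f : Fn n M) (p : M) : MDifferentiableAt (𝓡 n) 𝓘(ℝ, ℝ) f p :=
  (f.contMDiff p).mdifferentiableAt (by simp)

theorem VF.mdiff (X : VF n M) (p : M) :
    MDifferentiableAt (𝓡 n) (𝓡 n).tangent (fun q => (X q : TangentBundle (𝓡 n) M)) p :=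
  (X.contMDiff p).mdifferentiableAt (by simp)

theorem VF.contMDiff_act (X : VF n M) (f : Fn n M) :
    ContMDiff (𝓡 n) 𝓘(ℝ, ℝ) ∞ (fun p => mvfderiv (𝓡 n) f p (X p)) := by
  have h1 : ContMDiff (𝓡 n).tangent 𝓘(ℝ, ℝ).tangent ∞ (tangentMap (𝓡 n) 𝓘(ℝ, ℝ) f) :=
    f.contMDiff.contMDiff_tangentMap (by simp)
  have h2 := h1.comp X.contMDiff
  intro p
  have h3 := ((Bundle.contMDiffAt_totalSpace (F := ℝ) (E := TangentSpace 𝓘(ℝ, ℝ))).1 (h2 p)).2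
  refine h3.congr_of_eventuallyEq (Filter.Eventually.of_forall fun q => ?_)
  simp [mvfderiv, tangentMap]
  rfl

/-- The derivative `X f` of the function `f` along `X`. -/
noncomputable def VF.act (X : VF n M) (f : Fn n M) : Fn n M :=
  ⟨fun p => mvfderiv (𝓡 n) f p (X p), VF.contMDiff_act X f⟩

/-- The Lie bracket `[X, Y]` of vector fields. -/
noncomputable def VF.lie (X Y : VF n M) : VF n M :=
  ⟨mlieBracket (𝓡 n) X Y, by
    have : IsManifold (𝓡 n) (minSmoothness ℝ 2) M :=
      IsManifold.of_le (n := ∞) (by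
        rw [minSmoothness_of_isRCLikeNormedField]
        exact WithTop.coe_le_coe.2 (le_top : (2 : ℕ∞) ≤ ⊤))
    have : IsManifold (𝓡 n) (((⊤ : ℕ∞) : WithTop ℕ∞) + 1) M :=
      IsManifold.of_le (n := ∞) (by simp)
    exact ContDiff.mlieBracket_vectorField (m := ⊤) (n := ⊤) (I := 𝓡 n) X.contMDiff Y.contMDiff
      (by simp)⟩

theorem VF.act_apply (X : VF n M) (f : Fn n M) (p : M) :
    X.act f p = mvfderiv (𝓡 n) f p (X p) := rfl

theorem VF.lie_apply (X Y : VF n M) (p : M) : X.lie Y p = mlieBracket (𝓡 n) X Y p := rfl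

theorem VF.act_add (X : VF n M) (f g : Fn n M) : X.act (f + g) = X.act f + X.act g := by
  ext p
  simp [VF.act_apply, mvfderiv_add (f.mdiff p) (g.mdiff p)]

theorem VF.act_mul (X : VF n M) (f g : Fn n M) : X.act (f * g) = X.act f * g + f * X.act g := by
  ext p
  simp [VF.act_apply, mvfderiv_mul (f.mdiff p) (g.mdiff p)]
  ring

theorem VF.act_smul (X : VF n M) (c : ℝ) (f : Fn n M) : X.act (c • f) = c • X.act f := by
  ext p
  have : (⇑(c • f) : M → ℝ) = (fun _ : M => c) • (f : M → ℝ) := by ext; simp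
  rw [VF.act_apply, this, mvfderiv_smul (a := fun _ : M => c) mdifferentiableAt_const (f.mdiff p),
    mvfderiv_const]
  simp [VF.act_apply]

theorem VF.add_act (X Y : VF n M) (f : Fn n M) : (X + Y).act f = X.act f + Y.act f := by
  ext p; simp [VF.act_apply]

theorem VF.smul_act (g : Fn n M) (X : VF n M) (f : Fn n M) : (g • X).act f = g * X.act f := by
  ext p; simp [VF.act_apply]

theorem VF.lie_self (X : VF n M) : X.lie X = 0 := by
  ext p : 1; simp [VF.lie_apply]

theorem VF.lie_swap (X Y : VF n M) : X.lie Y = - Y.lie X := by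
  ext p : 1; simp [VF.lie_apply, mlieBracket_swap_apply (V := X)]

theorem VF.lie_add (X Y Z : VF n M) : X.lie (Y + Z) = X.lie Y + X.lie Z := by
  ext p : 1
  simp [VF.lie_apply, mlieBracket_add_right (Y.mdiff p) (Z.mdiff p)]

theorem VF.lie_smul (X : VF n M) (f : Fn n M) (Y : VF n M) :
    X.lie (f • Y) = X.act f • Y + f • X.lie Y := by
  ext p : 1
  exact mlieBracket_smul_right (f.mdiff p) (Y.mdiff p)

/-- Differential `k`-forms, as the alternating `C^∞(M)`-multilinear maps from vector fields to
functions. -/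
abbrev Form (n : ℕ) (M : Type*) [TopologicalSpace M] [ChartedSpace (Model n) M]
    [IsManifold (𝓡 n) ∞ M] (k : ℕ) : Type _ := VF n M [⋀^Fin k]→ₗ[Fn n M] Fn n M

/-- The contraction `ι_X η = η (X, …)`. -/
noncomputable def Form.contr {k : ℕ} (X : VF n M) (η : Form n M (k + 1)) : Form n M k :=
  η.curryLeft X

/-- The exterior product `a ∧ η` with a `1`-form `a`, normalised so that
`ι_X (a ∧ η) = a(X) η - a ∧ ι_X η`; see `Form.wedge_apply` and `Form.contr_wedge`. -/
noncomputable def Form.wedge {k : ℕ} (a : VF n M →ₗ[Fn n M] Fn n M) (η : Form n M k) :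
    Form n M (k + 1) :=
  AlternatingMap.alternatizeUncurryFin (a.smulRight η)

theorem Form.lie_aux {k : ℕ} (X : VF n M) (η : Form n M k) (v : Fin k → VF n M) (i j : Fin k)
    (h : v i = v j) (hij : i ≠ j) :
    X.act (η v) - ∑ l, η (Function.update v l (X.lie (v l))) = 0 := by
  have h0 : η v = 0 := η.map_eq_zero_of_eq v h hij
  have h1 : X.act (0 : Fn n M) = 0 := by simpa using X.act_add 0 0
  have h2 : ∑ l, η (Function.update v l (X.lie (v l))) =
      η (Function.update v i (X.lie (v i))) + η (Function.update v j (X.lie (v j))) := by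
    rw [← Finset.sum_pair (f := fun l => η (Function.update v l (X.lie (v l)))) hij]
    symm
    refine Finset.sum_subset (Finset.subset_univ _) fun l _ hl => ?_
    simp only [Finset.mem_insert, Finset.mem_singleton, not_or] at hl
    refine η.map_eq_zero_of_eq _ (i := i) (j := j) ?_ hij
    rw [Function.update_of_ne (Ne.symm hl.1), Function.update_of_ne (Ne.symm hl.2), h]
  have h3 : Function.update v i (X.lie (v i)) =
      Function.update v j (X.lie (v j)) ∘ Equiv.swap i j := by
    ext l : 1
    rcases eq_or_ne l i with rfl | hli
    · simp [h]
    rcases eq_or_ne l j with rfl | hlj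
    · simp [hij, hli, h]
    · simp [Equiv.swap_apply_of_ne_of_ne hli hlj, hli, hlj]
  rw [h0, h1, h2, h3, η.map_swap _ hij]
  simp

/-- The Lie derivative
`(L_X η)(v₁, …, v_k) = X (η (v₁, …, v_k)) - ∑ i, η (v₁, …, [X, v_i], …, v_k)`. -/
noncomputable def Form.lieD {k : ℕ} (X : VF n M) (η : Form n M k) : Form n M k where
  toFun v := X.act (η v) - ∑ i, η (Function.update v i (X.lie (v i)))
  map_update_add' := by
    intro inst v i Y Z
    obtain rfl : inst = instDecidableEqFin k := Subsingleton.elim _ _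
    have key : ∀ W : VF n M, ∑ l, η (Function.update (Function.update v i W) l
        (X.lie (Function.update v i W l))) = η (Function.update v i (X.lie W)) +
        ∑ l ∈ Finset.univ.erase i,
          η (Function.update (Function.update v l (X.lie (v l))) i W) := by
      intro W
      rw [← Finset.add_sum_erase _ _ (Finset.mem_univ i)]
      congr 1
      · simp
      · refine Finset.sum_congr rfl fun l hl => ?_
        have hl := Finset.ne_of_mem_erase hl
        rw [Function.update_comm hl.symm, Function.update_of_ne hl]
    simp only [key, VF.lie_add, AlternatingMap.map_update_add, VF.act_add, Finset.sum_add_distrib]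
    ring
  map_update_smul' := by
    intro inst v i f W
    obtain rfl : inst = instDecidableEqFin k := Subsingleton.elim _ _
    have key : ∀ W : VF n M, ∑ l, η (Function.update (Function.update v i W) l
        (X.lie (Function.update v i W l))) = η (Function.update v i (X.lie W)) +
        ∑ l ∈ Finset.univ.erase i,
          η (Function.update (Function.update v l (X.lie (v l))) i W) := by
      intro W
      rw [← Finset.add_sum_erase _ _ (Finset.mem_univ i)]
      congr 1
      · simp
      · refine Finset.sum_congr rfl fun l hl => ?_
        have hl := Finset.ne_of_mem_erase hl
        rw [Function.update_comm hl.symm, Function.update_of_ne hl]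
    simp only [key, VF.lie_smul, AlternatingMap.map_update_add, AlternatingMap.map_update_smul,
      smul_eq_mul, VF.act_mul, ← Finset.mul_sum]
    ring
  map_eq_zero_of_eq' v i j h hij := Form.lie_aux X η v i j h hij

theorem Form.lieD_apply {k : ℕ} (X : VF n M) (η : Form n M k) (v : Fin k → VF n M) :
    Form.lieD X η v = X.act (η v) - ∑ i, η (Function.update v i (X.lie (v i))) := rfl

theorem Form.lieD_add {k : ℕ} (X : VF n M) (η θ : Form n M k) :
    Form.lieD X (η + θ) = Form.lieD X η + Form.lieD X θ := by
  ext v : 1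
  simp only [Form.lieD_apply, AlternatingMap.add_apply, VF.act_add, Finset.sum_add_distrib]
  ring

theorem Form.lieD_smul {k : ℕ} (X : VF n M) (c : ℝ) (η : Form n M k) :
    Form.lieD X (c • η) = c • Form.lieD X η := by
  ext v : 1
  simp only [Form.lieD_apply, AlternatingMap.smul_apply, VF.act_smul, smul_sub, Finset.smul_sum]

theorem Form.lieD_fsmul {k : ℕ} (X : VF n M) (f : Fn n M) (η : Form n M k) :
    Form.lieD X (f • η) = X.act f • η + f • Form.lieD X η := by
  ext v : 1
  simp only [Form.lieD_apply, AlternatingMap.smul_apply, AlternatingMap.add_apply, VF.act_mul,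
    smul_eq_mul, ← Finset.mul_sum]
  ring

theorem Form.contr_apply {k : ℕ} (X : VF n M) (η : Form n M (k + 1)) (v : Fin k → VF n M) :
    Form.contr X η v = η (Matrix.vecCons X v) := rfl

theorem Form.ext_contr {k : ℕ} {η θ : Form n M (k + 1)}
    (h : ∀ X, Form.contr X η = Form.contr X θ) : η = θ := by
  ext v : 1
  have := congrArg (fun ξ : Form n M k => ξ (fun i => v i.succ)) (h (v 0))
  simp only [Form.contr_apply] at this
  have hv : Matrix.vecCons (v 0) (fun i => v i.succ) = v := by
    ext i : 1
    refine Fin.cases ?_ (fun j => ?_) i <;> rfl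
  rwa [hv] at this

theorem Form.contr_add {k : ℕ} (X : VF n M) (η θ : Form n M (k + 1)) :
    Form.contr X (η + θ) = Form.contr X η + Form.contr X θ := rfl

theorem Form.contr_smul {k : ℕ} (X : VF n M) (f : Fn n M) (η : Form n M (k + 1)) :
    Form.contr X (f • η) = f • Form.contr X η := rfl

theorem Form.contr_rsmul {k : ℕ} (X : VF n M) (c : ℝ) (η : Form n M (k + 1)) :
    Form.contr X (c • η) = c • Form.contr X η := rfl

theorem Form.add_contr {k : ℕ} (X Y : VF n M) (η : Form n M (k + 1)) :
    Form.contr (X + Y) η = Form.contr X η + Form.contr Y η := map_add η.curryLeft X Y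

theorem Form.smul_contr {k : ℕ} (f : Fn n M) (X : VF n M) (η : Form n M (k + 1)) :
    Form.contr (f • X) η = f • Form.contr X η := map_smul η.curryLeft f X

theorem Form.contr_contr {k : ℕ} (X : VF n M) (η : Form n M (k + 2)) :
    Form.contr X (Form.contr X η) = 0 := AlternatingMap.curryLeft_same η X

theorem Form.wedge_apply {k : ℕ} (a : VF n M →ₗ[Fn n M] Fn n M) (η : Form n M k)
    (v : Fin (k + 1) → VF n M) :
    Form.wedge a η v = ∑ i : Fin (k + 1), (-1) ^ (i : ℕ) • (a (v i) * η (i.removeNth v)) := by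
  simp [Form.wedge, AlternatingMap.alternatizeUncurryFin_apply]

theorem Form.contr_wedge_zero (X : VF n M) (a : VF n M →ₗ[Fn n M] Fn n M) (η : Form n M 0) :
    Form.contr X (Form.wedge a η) = a X • η := by
  ext v : 1
  simp [Form.contr_apply, Form.wedge_apply]

theorem Form.contr_wedge {k : ℕ} (X : VF n M) (a : VF n M →ₗ[Fn n M] Fn n M)
    (η : Form n M (k + 1)) :
    Form.contr X (Form.wedge a η) = a X • η - Form.wedge a (Form.contr X η) := by
  ext v : 1
  rw [Form.contr_apply, Form.wedge_apply, Fin.sum_univ_succ, AlternatingMap.sub_apply,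
    Form.wedge_apply, sub_eq_add_neg, ← Finset.sum_neg_distrib]
  congr 1
  · simp
  · refine Finset.sum_congr rfl fun i _ => ?_
    have : i.succ.removeNth (Matrix.vecCons X v) = Matrix.vecCons X (i.removeNth v) := by
      ext j : 1
      refine Fin.cases ?_ (fun l => ?_) j
      · simp [Fin.removeNth]
      · simp [Fin.removeNth]
    rw [this, Form.contr_apply]
    simp [pow_succ]

theorem Form.contr_lieD {k : ℕ} (X Y : VF n M) (η : Form n M (k + 1)) :
    Form.contr Y (Form.lieD X η) = Form.lieD X (Form.contr Y η) - Form.contr (X.lie Y) η := by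
  ext v : 1
  rw [AlternatingMap.sub_apply, Form.contr_apply, Form.lieD_apply, Form.lieD_apply,
    Form.contr_apply, Form.contr_apply, Fin.sum_univ_succ]
  have h1 : Function.update (Matrix.vecCons Y v) 0 (X.lie (Matrix.vecCons Y v 0)) =
      Matrix.vecCons (X.lie Y) v := by
    ext j : 1
    refine Fin.cases ?_ (fun l => ?_) j <;> simp
  have h2 : ∀ i : Fin k, Function.update (Matrix.vecCons Y v) i.succ
      (X.lie (Matrix.vecCons Y v i.succ)) =
      Matrix.vecCons Y (Function.update v i (X.lie (v i))) := by
    intro i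
    exact (Fin.cons_update (α := fun _ => VF n M) Y v i (X.lie (v i))).symm
  simp only [h1, h2, Form.contr_apply]
  ring

/-- The differential `df` of a function. -/
noncomputable def Fn.diff (f : Fn n M) : VF n M →ₗ[Fn n M] Fn n M where
  toFun X := X.act f
  map_add' X Y := VF.add_act X Y f
  map_smul' g X := VF.smul_act g X f

theorem Fn.diff_apply (f : Fn n M) (X : VF n M) : f.diff X = X.act f := rfl

theorem Form.smul_lieD {k : ℕ} (f : Fn n M) (X : VF n M) (η : Form n M (k + 1)) :
    Form.lieD (f • X) η = f • Form.lieD X η + Form.wedge f.diff (Form.contr X η) := by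
  have hlie : ∀ Y : VF n M, (f • X).lie Y = f • X.lie Y - Y.act f • X := by
    intro Y
    rw [VF.lie_swap, VF.lie_smul, VF.lie_swap Y X, smul_neg]
    abel
  have key : ∀ (v : Fin (k + 1) → VF n M) (i : Fin (k + 1)),
      η (Function.update v i X) = (-1) ^ (i : ℕ) • Form.contr X η (i.removeNth v) := by
    intro v i
    have := η.map_insertNth i X (i.removeNth v)
    rw [Fin.insertNth_removeNth] at this
    rw [this]
    rfl
  ext v : 1
  rw [AlternatingMap.add_apply, AlternatingMap.smul_apply, Form.lieD_apply, Form.lieD_apply,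
    Form.wedge_apply]
  simp only [hlie, AlternatingMap.map_update_sub, AlternatingMap.map_update_smul, key,
    VF.smul_act, Fn.diff_apply, Finset.sum_sub_distrib, smul_eq_mul, mul_sub, Finset.mul_sum]
  have : ∀ i : Fin (k + 1), (v i).act f * (-1) ^ (i : ℕ) • Form.contr X η (i.removeNth v) =
      (-1) ^ (i : ℕ) • ((v i).act f * Form.contr X η (i.removeNth v)) := by
    intro i
    rw [mul_smul_comm]
  simp only [this]
  ring

theorem Form.add_lieD {k : ℕ} (X Y : VF n M) (η : Form n M k) :
    Form.lieD (X + Y) η = Form.lieD X η + Form.lieD Y η := by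
  have hlie : ∀ Z : VF n M, (X + Y).lie Z = X.lie Z + Y.lie Z := by
    intro Z
    rw [VF.lie_swap, VF.lie_add, VF.lie_swap Z X, VF.lie_swap Z Y]
    abel
  ext v : 1
  simp only [Form.lieD_apply, AlternatingMap.add_apply, hlie, AlternatingMap.map_update_add,
    VF.add_act, Finset.sum_add_distrib]
  ring

/-- The form `ω` determined by its contractions `ι_X ω = F X`. -/
noncomputable def Form.ofContr {k : ℕ} (F : VF n M →ₗ[Fn n M] Form n M (k + 1))
    (hF : ∀ X, Form.contr X (F X) = 0) : Form n M (k + 2) where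
  toMultilinearMap := LinearMap.uncurryLeft (AlternatingMap.toMultilinearMapLM ∘ₗ F)
  map_eq_zero_of_eq' := by
    have h0 : ∀ (v : Fin (k + 2) → VF n M) (j : Fin (k + 1)), v 0 = v j.succ →
        F (v 0) (fun i => v i.succ) = 0 := by
      intro v j hj
      have h1 : ∀ u : Fin k → VF n M, F (v 0) (Matrix.vecCons (v 0) u) = 0 := fun u => by
        rw [← Form.contr_apply, hF]
        rfl
      rcases eq_or_ne j 0 with rfl | hj0
      · have := h1 (fun i => v i.succ.succ)
        convert this using 2
        ext i : 1
        refine Fin.cases ?_ (fun l => ?_) i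
        · simp [hj]
        · simp
      · have h2 := (F (v 0)).map_swap (fun i => v i.succ) hj0
        rw [← neg_eq_zero, ← h2]
        convert h1 (fun i => ((fun i : Fin (k + 1) => v i.succ) ∘ Equiv.swap j 0) i.succ) using 2
        ext i : 1
        refine Fin.cases ?_ (fun l => ?_) i
        · simp [hj]
        · simp
    intro v i j h hij
    change F (v 0) (fun i => v i.succ) = 0
    induction i using Fin.cases with
    | zero =>
      induction j using Fin.cases with
      | zero => exact absurd rfl hij
      | succ j => exact h0 v j h
    | succ i =>
      induction j using Fin.cases with
      | zero => exact h0 v i h.symm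
      | succ j =>
        exact (F (v 0)).map_eq_zero_of_eq _ h (fun e => hij (congrArg Fin.succ e))

theorem Form.contr_ofContr {k : ℕ} (F : VF n M →ₗ[Fn n M] Form n M (k + 1))
    (hF : ∀ X, Form.contr X (F X) = 0) (X : VF n M) :
    Form.contr X (Form.ofContr F hF) = F X := by
  ext v : 1
  rfl

/-- The exterior derivative on `k`-forms, together with the two identities that are needed to
define it on `(k + 1)`-forms. -/
structure ExtDerivStep (n : ℕ) (M : Type*) [TopologicalSpace M] [ChartedSpace (Model n) M]
    [IsManifold (𝓡 n) ∞ M] (k : ℕ) where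
  d : Form n M k →ₗ[ℝ] Form n M (k + 1)
  leibniz : ∀ (f : Fn n M) (η : Form n M k), d (f • η) = Form.wedge f.diff η + f • d η
  cartan : ∀ (X : VF n M) (η : Form n M (k + 1)),
    Form.contr X (d (Form.contr X η)) = Form.lieD X (Form.contr X η)

/-- A function as a `0`-form. -/
noncomputable def Form.ofFun (f : Fn n M) : Form n M 0 :=
  AlternatingMap.constOfIsEmpty (Fn n M) (VF n M) (Fin 0) f

/-- A `C^∞(M)`-linear functional on vector fields as a `1`-form. -/
noncomputable def Form.ofLin (a : VF n M →ₗ[Fn n M] Fn n M) : Form n M 1 :=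
  AlternatingMap.ofSubsingleton (Fn n M) (VF n M) (Fn n M) (0 : Fin 1) a

theorem Form.ext_zero {η θ : Form n M 0} (h : η ![] = θ ![]) : η = θ := by
  ext v : 1
  obtain rfl : v = ![] := Subsingleton.elim _ _
  exact h

theorem Form.contr_ofLin (X : VF n M) (a : VF n M →ₗ[Fn n M] Fn n M) :
    Form.contr X (Form.ofLin a) ![] = a X := rfl

/-- In degree `0`, `d` sends `f` to `df`. -/
noncomputable def extDerivZero : ExtDerivStep n M 0 where
  d :=
    { toFun := fun η => Form.ofLin (Fn.diff (η ![]))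
      map_add' := by
        intro η θ
        refine Form.ext_contr fun X => Form.ext_zero ?_
        exact X.act_add _ _
      map_smul' := by
        intro c η
        refine Form.ext_contr fun X => Form.ext_zero ?_
        exact X.act_smul _ _ }
  leibniz f η := by
    refine Form.ext_contr fun X => Form.ext_zero ?_
    rw [Form.contr_add, Form.contr_wedge_zero]
    exact X.act_mul f (η ![]) |>.trans (by
      simp only [AlternatingMap.add_apply, AlternatingMap.smul_apply, smul_eq_mul, Fn.diff_apply,
        Form.contr_smul]
      rfl)
  cartan X η := by
    refine Form.ext_zero ?_
    rw [Form.lieD_apply]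
    simp only [Finset.univ_eq_empty, Finset.sum_empty, sub_zero]
    rfl

/-- From degree `k` to degree `k + 1`: `ι_X (d η) = L_X η - d (ι_X η)`. -/
noncomputable def extDerivSucc {k : ℕ} (D : ExtDerivStep n M k) : ExtDerivStep n M (k + 1) :=
  let F (η : Form n M (k + 1)) : VF n M →ₗ[Fn n M] Form n M (k + 1) :=
    { toFun := fun X => Form.lieD X η - D.d (Form.contr X η)
      map_add' := fun X Y => by
        rw [Form.add_lieD, Form.add_contr, map_add]
        abel
      map_smul' := fun f X => by
        rw [Form.smul_lieD, Form.smul_contr, D.leibniz, RingHom.id_apply, smul_sub]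
        abel }
  have hF (η : Form n M (k + 1)) (X : VF n M) : Form.contr X (F η X) = 0 := by
    change Form.contr X (Form.lieD X η) - Form.contr X (D.d (Form.contr X η)) = 0
    rw [Form.contr_lieD, VF.lie_self, D.cartan]
    have : Form.contr (0 : VF n M) η = 0 := map_zero η.curryLeft
    rw [this, sub_zero, sub_self]
  have hc (η : Form n M (k + 1)) (X : VF n M) : Form.contr X (Form.ofContr (F η) (hF η)) =
    Form.lieD X η - D.d (Form.contr X η) := Form.contr_ofContr _ _ _
  { d :=
      { toFun := fun η => Form.ofContr (F η) (hF η)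
        map_add' := fun η θ => by
          refine Form.ext_contr fun X => ?_
          rw [Form.contr_add, hc, hc, hc, Form.lieD_add, Form.contr_add, map_add]
          abel
        map_smul' := fun c η => by
          refine Form.ext_contr fun X => ?_
          rw [RingHom.id_apply, Form.contr_rsmul, hc, hc, Form.lieD_smul, Form.contr_rsmul,
            map_smul, smul_sub] }
    leibniz := fun f η => by
      refine Form.ext_contr fun X => ?_
      change Form.contr X (Form.ofContr (F _) (hF _)) = Form.contr X (_ + f • Form.ofContr _ (hF _))
      rw [Form.contr_add, Form.contr_smul, hc, hc, Form.lieD_fsmul, Form.contr_smul, D.leibniz,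
        Form.contr_wedge, Fn.diff_apply, smul_sub]
      abel
    cartan := fun X η => by
      change Form.contr X (Form.ofContr (F _) (hF _)) = _
      rw [hc, Form.contr_contr, map_zero, sub_zero] }

/-- The exterior derivative in all degrees, by recursion on the degree. -/
noncomputable def extDerivStep (n : ℕ) (M : Type*) [TopologicalSpace M] [ChartedSpace (Model n) M]
    [IsManifold (𝓡 n) ∞ M] : ∀ k, ExtDerivStep n M k
  | 0 => extDerivZero
  | k + 1 => extDerivSucc (extDerivStep n M k)

/-- The exterior derivative. It is characterised by `Form.extDeriv_zero` (`d f = df`) and by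
the Cartan formula `Form.contr_extDeriv`. -/
noncomputable def Form.extDeriv {k : ℕ} : Form n M k →ₗ[ℝ] Form n M (k + 1) :=
  (extDerivStep n M k).d

theorem Form.extDeriv_zero (η : Form n M 0) : Form.extDeriv η = Form.ofLin (Fn.diff (η ![])) := rfl

theorem Form.contr_extDeriv {k : ℕ} (X : VF n M) (η : Form n M (k + 1)) :
    Form.contr X (Form.extDeriv η) = Form.lieD X η - Form.extDeriv (Form.contr X η) := by
  ext v : 1
  rfl

/-- Every tangent vector `v` at `p` extends to a vector field `e v`; the value of a
`C^∞(M)`-linear functional at `p` depends only on the value of the vector field at `p`, and every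
covector at `p` arises in this way. -/
theorem exists_extension [T2Space M] (p : M) :
    ∃ e : TangentSpace (𝓡 n) p →ₗ[ℝ] VF n M, (∀ v, e v p = v) ∧
      (∀ (a : VF n M →ₗ[Fn n M] Fn n M) (X : VF n M), a X p = a (e (X p)) p) ∧
      ∀ l : TangentSpace (𝓡 n) p →ₗ[ℝ] ℝ, ∃ a : VF n M →ₗ[Fn n M] Fn n M,
        ∀ X : VF n M, a X p = l (X p) := by
  let t := trivializationAt (Model n) (TangentSpace (𝓡 n) : M → Type _) p
  have hp : p ∈ t.baseSet :=
    FiberBundle.mem_baseSet_trivializationAt (Model n) (TangentSpace (𝓡 n) : M → Type _) p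
  obtain ⟨χ, -, hχ⟩ := (SmoothBumpFunction.nhds_basis_tsupport (I := 𝓡 n) p).mem_iff.1
    (t.open_baseSet.mem_nhds hp)
  let b := (EuclideanSpace.basisFun (Fin n) ℝ).toBasis
  let χ' : Fn n M := ⟨χ, χ.contMDiff⟩
  have hχp : χ' p = 1 := χ.eq_one
  let S : Fin n → VF n M := fun i => ⟨(χ : M → ℝ) • t.localFrame b i,
    ContMDiffOn.smul_section_of_tsupport χ.contMDiff.contMDiffOn t.open_baseSet hχ
      (t.contMDiffOn_localFrame_baseSet (n := ∞) b i)⟩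
  have hS : ∀ i q, S i q = χ' q • t.localFrame b i q := fun i q => rfl
  let c := t.localFrameCoeff (𝓡 n) b
  have hg : ∀ (X : VF n M) (i : Fin n),
      ContMDiff (𝓡 n) 𝓘(ℝ, ℝ) ∞ (fun q => χ q * c i q (X q)) := by
    intro X i
    refine contMDiff_of_tsupport fun q hq => ?_
    have hq' : q ∈ t.baseSet := by
      refine hχ (closure_mono (fun x hx => ?_) hq)
      exact left_ne_zero_of_mul hx
    exact χ.contMDiffAt.mul (contMDiffAt_localFrameCoeff b hq' (X.contMDiff q) i)
  let g : VF n M → Fin n → Fn n M := fun X i => ⟨fun q => χ q * c i q (X q), hg X i⟩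
  have hsum : ∀ (T : Fin n → VF n M) (q : M), (∑ i, T i) q = ∑ i, T i q := by
    intro T q
    have : (⇑(∑ i, T i) : ∀ q, TangentSpace (𝓡 n) q) = ∑ i, ⇑(T i) :=
      map_sum (ContMDiffSection.coeAddHom (𝓡 n) (Model n) ∞ (TangentSpace (𝓡 n) : M → Type _)) _ _
    rw [this, Finset.sum_apply]
  have hX : ∀ X : VF n M, (χ' * χ') • X = ∑ i, g X i • S i := by
    intro X
    ext q : 1
    rw [hsum]
    change _ = ∑ i, g X i q • S i q
    by_cases hq : q ∈ t.baseSet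
    · have h1 := t.eq_sum_localFrameCoeff_smul (I := 𝓡 n) (b := b) (s := X) hq
      have h2 : ((χ' * χ') • X) q = (χ' q * χ' q) • X q := rfl
      rw [h2, h1, Finset.smul_sum]
      refine Finset.sum_congr rfl fun i _ => ?_
      rw [hS, smul_smul, smul_smul]
      congr 1
      have : g X i q = χ' q * c i q (X q) := rfl
      rw [this]
      ring
    · have h0 : χ' q = 0 := by
        by_contra h
        exact hq (hχ (subset_tsupport _ h))
      have h2 : ((χ' * χ') • X) q = (χ' q * χ' q) • X q := rfl
      simp [h2, hS, h0]
  refine ⟨∑ i, (c i p).smulRight (S i), fun v => ?_, fun a X => ?_, fun l => ?_⟩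
  · have h1 := t.eq_sum_localFrameCoeff_smul (I := 𝓡 n) (b := b)
      (s := FiberBundle.extend (Model n) v) hp
    rw [FiberBundle.extend_apply_self] at h1
    rw [LinearMap.sum_apply, hsum]
    refine Eq.trans (Finset.sum_congr rfl fun i _ => ?_) h1.symm
    change c i p v • S i p = _
    rw [hS, hχp, one_smul]
  · have h1 : (χ' * χ') • a X = ∑ i, g X i • a (S i) := by
      rw [← map_smul, hX, map_sum]
      simp
    have h2 := congrArg (ContMDiffMap.evalRingHom p) h1
    rw [map_sum] at h2
    have h3 : a X p = ∑ i, g X i p * a (S i) p := by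
      refine Eq.trans ?_ h2
      change _ = (χ' p * χ' p) * a X p
      rw [hχp, one_mul, one_mul]
    have h4 : a ((∑ i, (c i p).smulRight (S i)) (X p)) = ∑ i, c i p (X p) • a (S i) := by
      rw [LinearMap.sum_apply, map_sum]
      exact Finset.sum_congr rfl fun i _ => LinearMap.map_smul_of_tower a _ _
    have h5 := congrArg (ContMDiffMap.evalRingHom p) h4
    rw [map_sum] at h5
    refine h3.trans (Eq.trans ?_ h5.symm)
    refine Finset.sum_congr rfl fun i _ => ?_
    change (χ' p * c i p (X p)) * a (S i) p = c i p (X p) * a (S i) p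
    rw [hχp, one_mul]
  · let G : Fin n → VF n M →ₗ[Fn n M] Fn n M := fun i =>
      { toFun := fun X => g X i
        map_add' := fun X Y => by
          ext q
          change χ q * c i q (X q + Y q) = χ q * c i q (X q) + χ q * c i q (Y q)
          rw [map_add, mul_add]
        map_smul' := fun f X => by
          ext q
          change χ q * c i q (f q • X q) = f q * (χ q * c i q (X q))
          rw [map_smul, smul_eq_mul]
          ring }
    refine ⟨∑ i, l (S i p) • G i, fun X => ?_⟩
    have h1 := t.eq_sum_localFrameCoeff_smul (I := 𝓡 n) (b := b) (s := X) hp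
    have h2 : (∑ i, l (S i p) • G i) X = ∑ i, l (S i p) • g X i := by
      rw [LinearMap.sum_apply]
      rfl
    have h3 := congrArg (ContMDiffMap.evalRingHom p) h2
    rw [map_sum] at h3
    refine h3.trans ?_
    rw [h1, map_sum]
    refine Finset.sum_congr rfl fun i _ => ?_
    change l (S i p) * (χ' p * c i p (X p)) = l (c i p (X p) • t.localFrame b i p)
    rw [map_smul, hS, hχp, one_smul, one_mul, smul_eq_mul, mul_comm]


/-- The sections of the cotangent bundle, as the `C^∞(M)`-linear functionals on vector fields. -/
abbrev OneForm (n : ℕ) (M : Type*) [TopologicalSpace M] [ChartedSpace (Model n) M]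
    [IsManifold (𝓡 n) ∞ M] : Type _ := VF n M →ₗ[Fn n M] Fn n M

/-- The value at the point `p` of a `1`-form, a covector; it is characterised by
`OneForm.at_apply`. -/
noncomputable def OneForm.at [T2Space M] (a : OneForm n M) (p : M) :
    Module.Dual ℝ (TangentSpace (𝓡 n) p) where
  toFun v := a ((exists_extension (n := n) p).choose v) p
  map_add' v w := by
    rw [map_add, map_add]
    rfl
  map_smul' c v := by
    rw [map_smul, LinearMap.map_smul_of_tower]
    rfl

theorem OneForm.at_apply [T2Space M] (a : OneForm n M) (p : M) (X : VF n M) :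
    a.at p (X p) = a X p :=
  ((exists_extension (n := n) p).choose_spec.2.1 a X).symm

/-- Sections `X + α` of the generalized tangent bundle `𝕋M = TM ⊕ T*M`. -/
abbrev Sec (n : ℕ) (M : Type*) [TopologicalSpace M] [ChartedSpace (Model n) M]
    [IsManifold (𝓡 n) ∞ M] : Type _ := VF n M × OneForm n M

/-- The fibre `T_pM ⊕ T_p*M` of the generalized tangent bundle. -/
abbrev Fib (n : ℕ) (M : Type*) [TopologicalSpace M] [ChartedSpace (Model n) M] (p : M) : Type :=
  TangentSpace (𝓡 n) p × Module.Dual ℝ (TangentSpace (𝓡 n) p)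

/-- The value of a section of `𝕋M` at the point `p`. -/
noncomputable def Sec.at [T2Space M] (x : Sec n M) (p : M) : Fib n M p := (x.1 p, x.2.at p)

theorem exists_vf [T2Space M] (p : M) (v : TangentSpace (𝓡 n) p) : ∃ X : VF n M, X p = v :=
  ⟨_, (exists_extension (n := n) p).choose_spec.1 v⟩

theorem OneForm.at_eq_iff [T2Space M] (a : OneForm n M) (p : M)
    (l : Module.Dual ℝ (TangentSpace (𝓡 n) p)) : a.at p = l ↔ ∀ X : VF n M, a X p = l (X p) := by
  constructor
  · rintro rfl X
    exact (a.at_apply p X).symm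
  · intro h
    ext v
    obtain ⟨X, rfl⟩ := exists_vf (n := n) p v
    rw [OneForm.at_apply, h]

theorem Sec.at_surjective [T2Space M] (p : M) :
    Function.Surjective fun x : Sec n M => x.at p := by
  rintro ⟨v, l⟩
  obtain ⟨X, rfl⟩ := exists_vf (n := n) p v
  obtain ⟨a, ha⟩ := (exists_extension (n := n) p).choose_spec.2.2 l
  exact ⟨(X, a), Prod.ext rfl ((OneForm.at_eq_iff a p l).2 ha)⟩

theorem Sec.at_add [T2Space M] (x y : Sec n M) (p : M) : (x + y).at p = x.at p + y.at p := by
  refine Prod.ext rfl ((OneForm.at_eq_iff _ p _).2 fun X => ?_)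
  change (x.2 + y.2) X p = (x.2.at p + y.2.at p) (X p)
  rw [LinearMap.add_apply, LinearMap.add_apply, OneForm.at_apply, OneForm.at_apply]
  rfl

theorem Sec.at_smul [T2Space M] (c : ℝ) (x : Sec n M) (p : M) : (c • x).at p = c • x.at p := by
  refine Prod.ext rfl ((OneForm.at_eq_iff _ p _).2 fun X => ?_)
  change (c • x.2) X p = (c • x.2.at p) (X p)
  rw [LinearMap.smul_apply, LinearMap.smul_apply, OneForm.at_apply]
  rfl

theorem Sec.ext_at [T2Space M] {x y : Sec n M} (h : ∀ p, x.at p = y.at p) : x = y := by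
  refine Prod.ext ?_ ?_
  · ext p : 1
    exact congrArg Prod.fst (h p)
  · ext X p
    have := (OneForm.at_eq_iff x.2 p _).1 (congrArg Prod.snd (h p)) X
    exact this.trans (OneForm.at_apply y.2 p X)

/-- The tautological inner product `⟨X + α, Y + β⟩ = (α(Y) + β(X)) / 2`. -/
noncomputable def pairing (x y : Sec n M) : Fn n M := (1 / 2 : ℝ) • (x.2 y.1 + y.2 x.1)

/-- A bundle endomorphism of `𝕋M`, given as a `C^∞(M)`-linear endomorphism of its sections, is
skew-symmetric with respect to the tautological inner product. -/
def IsSkew (φ : Module.End (Fn n M) (Sec n M)) : Prop :=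
  ∀ x y, pairing (φ x) y + pairing x (φ y) = 0

noncomputable instance : Ring (Module.End (Fn n M) (Sec n M)) := inferInstance

noncomputable instance : Algebra ℝ (Module.End (Fn n M) (Sec n M)) := inferInstance

/-- The space `Ω_M` of all differential forms, the direct sum of the `Ω^k`. -/
def Omega (n : ℕ) (M : Type*) [TopologicalSpace M] [ChartedSpace (Model n) M]
    [IsManifold (𝓡 n) ∞ M] : Type _ := DirectSum ℕ (fun k => Form n M k)

noncomputable instance : AddCommGroup (Omega n M) :=
  inferInstanceAs (AddCommGroup (DirectSum ℕ (fun k => Form n M k)))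

noncomputable instance : Module ℝ (Omega n M) :=
  inferInstanceAs (Module ℝ (DirectSum ℕ (fun k => Form n M k)))

/-- The algebra `E_M` of `ℝ`-linear endomorphisms of `Ω_M`. -/
abbrev Op (n : ℕ) (M : Type*) [TopologicalSpace M] [ChartedSpace (Model n) M]
    [IsManifold (𝓡 n) ∞ M] : Type _ := Module.End ℝ (Omega n M)

/-- The inclusion of `Ω^k` in `Ω_M`. -/
noncomputable def Omega.of (k : ℕ) : Form n M k →ₗ[ℝ] Omega n M :=
  DirectSum.lof ℝ ℕ (fun k => Form n M k) k

/-- The operator that is `F k` on `Ω^k`. -/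
noncomputable def opOf (F : ∀ k, Form n M k →ₗ[ℝ] Omega n M) : Op n M :=
  DirectSum.toModule ℝ ℕ (Omega n M) F

theorem opOf_of (F : ∀ k, Form n M k →ₗ[ℝ] Omega n M) (k : ℕ) (η : Form n M k) :
    opOf F (Omega.of k η) = F k η := DirectSum.toModule_lof ℝ k η

theorem Op.ext_of {A B : Op n M} (h : ∀ k η, A (Omega.of k η) = B (Omega.of k η)) : A = B :=
  DirectSum.linearMap_ext ℝ fun k => LinearMap.ext fun η => h k η

/-- Multiplication by a function. -/
noncomputable def fnOp (f : Fn n M) : Op n M :=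
  opOf fun k => Omega.of k ∘ₗ
    { toFun := fun η => f • η
      map_add' := fun η θ => smul_add f η θ
      map_smul' := fun c η => smul_comm f c η }

/-- Contraction with a vector field; it is zero on `Ω⁰`. -/
noncomputable def contrOp (X : VF n M) : Op n M :=
  opOf fun
    | 0 => 0
    | k + 1 => Omega.of k ∘ₗ
      { toFun := fun η => Form.contr X η
        map_add' := fun η θ => Form.contr_add X η θ
        map_smul' := fun c η => Form.contr_rsmul X c η }

theorem Form.wedge_add {k : ℕ} (a : OneForm n M) (η θ : Form n M k) :
    Form.wedge a (η + θ) = Form.wedge a η + Form.wedge a θ := by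
  ext v : 1
  simp only [Form.wedge_apply, AlternatingMap.add_apply, mul_add, smul_add, Finset.sum_add_distrib]

theorem Form.wedge_smul {k : ℕ} (a : OneForm n M) (c : ℝ) (η : Form n M k) :
    Form.wedge a (c • η) = c • Form.wedge a η := by
  ext v : 1
  simp only [Form.wedge_apply, AlternatingMap.smul_apply, Finset.smul_sum, mul_smul_comm,
    smul_comm c]

/-- Exterior multiplication by a `1`-form. -/
noncomputable def wedgeOp (a : OneForm n M) : Op n M :=
  opOf fun k => Omega.of (k + 1) ∘ₗ
    { toFun := fun η => Form.wedge a η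
      map_add' := fun η θ => Form.wedge_add a η θ
      map_smul' := fun c η => Form.wedge_smul a c η }

/-- The exterior derivative as an operator on `Ω_M`. -/
noncomputable def dOp : Op n M := opOf fun k => Omega.of (k + 1) ∘ₗ Form.extDeriv

/-- The section `X + α` of `𝕋M` as the operator `ι_X + α ∧`. -/
noncomputable def Sec.op (x : Sec n M) : Op n M := contrOp x.1 + wedgeOp x.2

/-- The parity operator, `(-1)^k` on `Ω^k`. -/
noncomputable def signOp : Op n M := opOf fun k => (-1 : ℝ) ^ k • Omega.of (n := n) (M := M) k

/-- The component of an operator that preserves the parity of forms. -/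
noncomputable def evenPart : Op n M →ₗ[ℝ] Op n M where
  toFun A := (1 / 2 : ℝ) • (A + signOp * A * signOp)
  map_add' A B := by
    rw [mul_add, add_mul, ← smul_add]
    congr 1
    abel
  map_smul' c A := by
    rw [mul_smul_comm, smul_mul_assoc, ← smul_add, smul_comm, RingHom.id_apply]

/-- The component of an operator that reverses the parity of forms. -/
noncomputable def oddPart : Op n M →ₗ[ℝ] Op n M := LinearMap.id - evenPart

/-- The graded commutator: the bilinear operation with `[A, B] = A B - (-1)^{kl} B A` for `A` of
degree `k` and `B` of degree `l`. -/
noncomputable def gcomm (A B : Op n M) : Op n M :=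
  A * B - evenPart B * A - oddPart B * evenPart A + oddPart B * oddPart A

theorem gcomm_of_even_right {A B : Op n M} (hB : evenPart B = B) : gcomm A B = A * B - B * A := by
  simp [gcomm, oddPart, hB]

theorem gcomm_of_even_left {A B : Op n M} (hA : evenPart A = A) : gcomm A B = A * B - B * A := by
  have hAo : oddPart A = 0 := by simp [oddPart, hA]
  have hB : oddPart B = B - evenPart B := rfl
  rw [gcomm, hAo, hA, hB, sub_mul, mul_zero]
  abel

theorem gcomm_of_odd {A B : Op n M} (hA : evenPart A = 0) (hB : evenPart B = 0) :
    gcomm A B = A * B + B * A := by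
  simp [gcomm, oddPart, hA, hB]

/-- The adjoint action `ad_A = [A, ·]`. -/
noncomputable def adOp (A : Op n M) : Module.End ℝ (Op n M) where
  toFun B := gcomm A B
  map_add' B C := by
    simp only [gcomm, map_add, mul_add, add_mul]
    abel
  map_smul' c B := by
    simp only [gcomm, map_smul, mul_smul_comm, smul_mul_assoc, smul_sub, smul_add,
      RingHom.id_apply]

/-- The derived bracket `⟦A, B⟧_δ = [[A, δ], B]`. -/
noncomputable def derivedBracket (δ : Op n M) (A B : Op n M) : Op n M := gcomm (gcomm A δ) B

/-- `L` is the lift of the skew-symmetric endomorphism `φ` to differential forms: the even operator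
with `[L, f] = 0` for functions `f`, `[L, x] = φ(x)` for sections `x` of `𝕋M`, and `L(1) ∈ Ω²`. -/
structure IsLift (φ : Module.End (Fn n M) (Sec n M)) (L : Op n M) : Prop where
  even : evenPart L = L
  fn : ∀ f, gcomm L (fnOp f) = 0
  sec : ∀ x : Sec n M, gcomm L x.op = (φ x).op
  one : ∃ η : Form n M 2, L (Omega.of 0 (Form.ofFun 1)) = Omega.of 2 η

/-- The Dorfman bracket `⟦X + α, Y + β⟧ = [X, Y] + L_X β - ι_Y dα`. -/
noncomputable def dorfman (x y : Sec n M) : Sec n M :=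
  (x.1.lie y.1,
    (AlternatingMap.ofSubsingleton (Fn n M) (VF n M) (Fn n M) (0 : Fin 1)).symm
      (Form.lieD x.1 (Form.ofLin y.2) - Form.contr y.1 (Form.extDeriv (Form.ofLin x.2))))

/-- The Courant–Nijenhuis torsion
`φ²⟦x, y⟧ + ⟦φ x, φ y⟧ - φ (⟦φ x, y⟧ + ⟦x, φ y⟧)`. -/
noncomputable def torsion (φ : Module.End (Fn n M) (Sec n M)) (x y : Sec n M) : Sec n M :=
  φ (φ (dorfman x y)) + dorfman (φ x) (φ y) - φ (dorfman (φ x) y + dorfman x (φ y))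

/-- The bivariate Courant–Nijenhuis torsion of two operators. -/
noncomputable def bivariateTorsion (φ' φ'' : Module.End (Fn n M) (Sec n M)) (x y : Sec n M) :
    Sec n M :=
  torsion (φ' + φ'') x y - torsion φ' x y - torsion φ'' x y

open Polynomial

/-- `P` is a monic polynomial of least degree that annihilates `φ`. -/
def IsMinimalPolynomial (φ : Module.End (Fn n M) (Sec n M)) (P : ℝ[X]) : Prop :=
  P.Monic ∧ aeval φ P = 0 ∧ ∀ Q : ℝ[X], Q.Monic → aeval φ Q = 0 → P.natDegree ≤ Q.natDegree

/-- Generalized polynomial structures: skew-symmetric bundle endomorphisms of `𝕋M` whose minimal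
polynomial at every point is the same monic polynomial `P` of positive degree. Here `φp` is the
endomorphism that `φ` induces on the fibre of `𝕋M` at `p`. -/
structure IsGPS [T2Space M] (φ : Module.End (Fn n M) (Sec n M)) : Prop where
  skew : IsSkew φ
  minpoly : ∃ P : ℝ[X], P.Monic ∧ 1 ≤ P.natDegree ∧ ∀ p : M, ∃ φp : Module.End ℝ (Fib n M p),
    (∀ x : Sec n M, φp (x.at p) = (φ x).at p) ∧ minpoly ℝ φp = P

/-- The common minimal polynomial of the endomorphisms that `φ` induces on the fibres is the monic
polynomial of least degree that annihilates `φ`. -/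
theorem isMinimalPolynomial_of_fibers [T2Space M] [Nonempty M] (φ : Module.End (Fn n M) (Sec n M))
    (P : ℝ[X])
    (h : ∀ p : M, ∃ φp : Module.End ℝ (Fib n M p),
      (∀ x : Sec n M, φp (x.at p) = (φ x).at p) ∧ minpoly ℝ φp = P) :
    IsMinimalPolynomial φ P := by
  have key : ∀ (p : M) (φp : Module.End ℝ (Fib n M p)),
      (∀ x : Sec n M, φp (x.at p) = (φ x).at p) → ∀ (Q : ℝ[X]) (x : Sec n M),
        aeval φp Q (x.at p) = (aeval φ Q x).at p := by
    intro p φp hφ Q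
    induction Q using Polynomial.induction_on' with
    | add Q R hQ hR =>
      intro x
      have e1 : aeval φp (Q + R) = aeval φp Q + aeval φp R := (aeval φp).map_add' Q R
      have e2 : aeval φ (Q + R) = aeval φ Q + aeval φ R := (aeval φ).map_add' Q R
      rw [e1, e2, LinearMap.add_apply, LinearMap.add_apply, hQ, hR, Sec.at_add]
    | monomial k c =>
      intro x
      rw [aeval_monomial, aeval_monomial, Algebra.algebraMap_eq_smul_one,
        Algebra.algebraMap_eq_smul_one, smul_mul_assoc, smul_mul_assoc, one_mul, one_mul,
        LinearMap.smul_apply, LinearMap.smul_apply, Sec.at_smul]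
      congr 1
      induction k generalizing x with
      | zero => rfl
      | succ k ih => rw [pow_succ, pow_succ, Module.End.mul_apply, Module.End.mul_apply, hφ, ih]
  have hfin : ∀ p : M, FiniteDimensional ℝ (Fib n M p) := fun p => by
    have : FiniteDimensional ℝ (TangentSpace (𝓡 n) p) :=
      inferInstanceAs (FiniteDimensional ℝ (EuclideanSpace ℝ (Fin n)))
    infer_instance
  refine ⟨?_, ?_, fun Q hQ hQ0 => ?_⟩
  · obtain ⟨φp, -, rfl⟩ := h (Classical.arbitrary M)
    have := hfin (Classical.arbitrary M)
    exact minpoly.monic (Algebra.IsIntegral.isIntegral φp)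
  · refine LinearMap.ext fun x => Sec.ext_at fun p => ?_
    obtain ⟨φp, hφ, rfl⟩ := h p
    rw [← key p φp hφ]
    refine (congrArg (fun A : Module.End ℝ (Fib n M p) => A (x.at p)) (minpoly.aeval ℝ φp)).trans ?_
    have := Sec.at_smul (0 : ℝ) (0 : Sec n M) p
    rw [zero_smul, zero_smul] at this
    exact this.symm
  · obtain ⟨φp, hφ, rfl⟩ := h (Classical.arbitrary M)
    refine natDegree_le_of_dvd (minpoly.dvd ℝ φp (LinearMap.ext fun v => ?_)) hQ.ne_zero
    obtain ⟨x, rfl⟩ := Sec.at_surjective (n := n) _ v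
    have := key _ φp hφ Q x
    rw [hQ0, LinearMap.zero_apply] at this
    refine this.trans ?_
    have := Sec.at_smul (0 : ℝ) (0 : Sec n M) (Classical.arbitrary M)
    rw [zero_smul, zero_smul] at this
    exact this

/-- The minimal operator `P(ad_L)(d)`. -/
noncomputable def minimalOp (L : Op n M) (P : ℝ[X]) : Op n M := aeval (adOp L) P dOp

/-- `φ` is minimal: with `P` the minimal polynomial of `φ` and `L` its lift to differential forms, the
minimal torsion `(x, y) ↦ ⟦x, y⟧_δ`, `δ = P(ad_L)(d)`, vanishes. -/
def IsMinimal (φ : Module.End (Fn n M) (Sec n M)) : Prop :=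
  ∃ (P : ℝ[X]) (L : Op n M), IsMinimalPolynomial φ P ∧ IsLift φ L ∧
    ∀ x y : Sec n M, derivedBracket (minimalOp L P) x.op y.op = 0

end
end GenPoly

open GenPoly Polynomial

/-!
The proof turns minimality into an identity for polynomials in commuting operators that act on the
Dorfman bracket.

An endomorphism `φ` of `𝕋M` acts on the biadditive maps `b` on sections of `𝕋M` by
`(N_φ b)(x, y) = φ (b(x, y)) - b(φ x, y) - b(x, φ y)` (`bracketAction`). If `L` is a lift of `φ`, then
`ad_L` is a derivation of the graded commutator with `[L, x] = φ x`, so passing from `δ` to `ad_L δ`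
changes the derived bracket `⟦x, y⟧_δ` by `N_φ` (`Represents.ad`). The derived bracket of `d` is
the Dorfman bracket (`derivedBracket_dOp`, by Cartan calculus). Hence the derived bracket of
`P(ad_L)(d)` is `P(N_φ)` applied to the Dorfman bracket `b₀` (`represents_minimalOp`), and `φ` is
minimal when the values of `P(N_φ) b₀`, regarded as operators on forms, vanish for its minimal
polynomial `P`.

Write `N'`, `N''` for the actions of `φ'`, `φ''`. As `φ' φ'' = φ'' φ' = 0`, the operators `N'` and
`N''` commute, and `N' N'' b₀` is the bivariate Courant–Nijenhuis torsion
(`bracketAction_bracketAction_dorfmanHom`), which vanishes. So all mixed terms drop out: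
`P(N' + N'') b₀ + P(0) b₀ = P(N') b₀ + P(N'') b₀`
(`aeval_add_apply_of_apply_apply_eq_zero`). The terms on the right vanish because `φ'` and `φ''` are
minimal and `P` is a multiple of both minimal polynomials (`IsMinimal.exists_isLift`). The same
identity for `φ'` and `φ''` in place of `N'` and `N''` shows that `P(0)` annihilates all sections. The
sum of lifts of `φ'` and `φ''` is a lift of `φ' + φ''`, which completes the argument.
-/

namespace GenPoly

section
variable {n : ℕ} {M : Type*} [TopologicalSpace M] [ChartedSpace (Model n) M]
  [IsManifold (𝓡 n) ∞ M]

/-! ### Action of the basic operators on homogeneous forms -/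

theorem fnOp_of (f : Fn n M) (k : ℕ) (η : Form n M k) :
    fnOp f (Omega.of k η) = Omega.of k (f • η) := opOf_of _ _ _

theorem contrOp_of_zero (X : VF n M) (η : Form n M 0) : contrOp X (Omega.of 0 η) = 0 :=
  opOf_of _ _ _

theorem contrOp_of_succ (X : VF n M) (k : ℕ) (η : Form n M (k + 1)) :
    contrOp X (Omega.of (k + 1) η) = Omega.of k (Form.contr X η) := opOf_of _ _ _

theorem wedgeOp_of (a : OneForm n M) (k : ℕ) (η : Form n M k) :
    wedgeOp a (Omega.of k η) = Omega.of (k + 1) (Form.wedge a η) := opOf_of _ _ _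

theorem dOp_of (k : ℕ) (η : Form n M k) :
    dOp (Omega.of k η) = Omega.of (k + 1) (Form.extDeriv η) := opOf_of _ _ _

theorem signOp_of (k : ℕ) (η : Form n M k) :
    signOp (Omega.of k η) = (-1 : ℝ) ^ k • Omega.of k η := opOf_of _ _ _

theorem Omega.of_injective (k : ℕ) : Function.Injective (Omega.of (n := n) (M := M) k) :=
  DirectSum.of_injective (β := fun k => Form n M k) k

/-- The Lie derivative as an operator on `Ω_M`. -/
noncomputable def lieOp (X : VF n M) : Op n M :=
  opOf fun k => Omega.of k ∘ₗ
    { toFun := fun η => Form.lieD X η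
      map_add' := fun η θ => Form.lieD_add X η θ
      map_smul' := fun c η => Form.lieD_smul X c η }

theorem lieOp_of (X : VF n M) (k : ℕ) (η : Form n M k) :
    lieOp X (Omega.of k η) = Omega.of k (Form.lieD X η) := opOf_of _ _ _

/-- The Lie derivative `(L_X a)(Y) = X (a(Y)) - a([X, Y])` of a `1`-form, as a `1`-form. -/
noncomputable def OneForm.lieD (X : VF n M) (a : OneForm n M) : OneForm n M :=
  (AlternatingMap.ofSubsingleton (Fn n M) (VF n M) (Fn n M) (0 : Fin 1)).symm
    (Form.lieD X (Form.ofLin a))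

theorem OneForm.lieD_apply (X Y : VF n M) (a : OneForm n M) :
    OneForm.lieD X a Y = X.act (a Y) - a (X.lie Y) := by
  change X.act _ - ∑ i : Fin 1, _ = _
  rw [Fin.sum_univ_one]
  change X.act (a Y) - a _ = _
  congr 2

/-- By Cartan's formula, `ι_Y dα = L_Y α - d (α(Y))` for a `1`-form `α`. -/
theorem dorfman_eq (x y : Sec n M) :
    dorfman x y = (x.1.lie y.1,
      OneForm.lieD x.1 y.2 - (OneForm.lieD y.1 x.2 - (x.2 y.1).diff)) := by
  refine Prod.ext rfl (LinearMap.ext fun Z => ?_)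
  rw [dorfman, Form.contr_extDeriv, Form.extDeriv_zero, Form.contr_ofLin]
  rfl

/-! ### Parity of operators -/

theorem signOp_mul_self : (signOp : Op n M) * signOp = 1 := by
  refine Op.ext_of fun k η => ?_
  rw [Module.End.mul_apply, signOp_of, map_smul, signOp_of, smul_smul, ← mul_pow]
  simp

theorem evenPart_eq_self_iff {A : Op n M} : evenPart A = A ↔ signOp * A = A * signOp := by
  have hs : (signOp : Op n M) * signOp = 1 := signOp_mul_self
  have e : evenPart A = (1 / 2 : ℝ) • (A + signOp * A * signOp) := rfl
  constructor
  · intro h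
    have h1 : signOp * A * signOp = A := by
      have h2 : (2 : ℝ) • evenPart A = A + signOp * A * signOp := by
        rw [e, smul_smul]; norm_num
      rw [h, two_smul] at h2
      exact (add_left_cancel h2).symm
    calc signOp * A = signOp * A * (signOp * signOp) := by rw [hs, mul_one]
      _ = signOp * A * signOp * signOp := by rw [mul_assoc (signOp * A)]
      _ = A * signOp := by rw [h1]
  · intro h
    rw [e, h, mul_assoc, hs, mul_one, ← two_smul ℝ A, smul_smul]
    norm_num

theorem evenPart_eq_zero_of_anticomm {A : Op n M} (h : signOp * A = -(A * signOp)) :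
    evenPart A = 0 := by
  have e : evenPart A = (1 / 2 : ℝ) • (A + signOp * A * signOp) := rfl
  rw [e, h, neg_mul, mul_assoc, signOp_mul_self, mul_one, add_neg_cancel, smul_zero]

theorem signOp_contrOp (X : VF n M) : signOp * contrOp X = -(contrOp X * signOp) := by
  refine Op.ext_of fun k η => ?_
  rw [LinearMap.neg_apply, Module.End.mul_apply, Module.End.mul_apply, signOp_of, map_smul]
  cases k with
  | zero => simp [contrOp_of_zero]
  | succ k => simp [contrOp_of_succ, signOp_of, pow_succ]

theorem signOp_wedgeOp (a : OneForm n M) : signOp * wedgeOp a = -(wedgeOp a * signOp) := by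
  refine Op.ext_of fun k η => ?_
  simp [wedgeOp_of, signOp_of, pow_succ]

theorem signOp_dOp : (signOp : Op n M) * dOp = -(dOp * signOp) := by
  refine Op.ext_of fun k η => ?_
  simp [dOp_of, signOp_of, pow_succ]

theorem signOp_secOp (x : Sec n M) : signOp * x.op = -(x.op * signOp) := by
  rw [Sec.op, mul_add, add_mul, signOp_contrOp, signOp_wedgeOp, neg_add]

/-- The commutator with an even operator is a derivation of the graded commutator, whatever the
parity of the two arguments. -/
theorem gcomm_gcomm_of_even {L : Op n M} (hL : evenPart L = L) (A B : Op n M) :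
    gcomm L (gcomm A B) = gcomm (gcomm L A) B + gcomm A (gcomm L B) := by
  have hs := evenPart_eq_self_iff.1 hL
  have he : ∀ C : Op n M, evenPart (L * C - C * L) = L * evenPart C - evenPart C * L := by
    intro C
    have e : ∀ D : Op n M, evenPart D = (1 / 2 : ℝ) • (D + signOp * D * signOp) := fun D => rfl
    have h1 : signOp * (L * C - C * L) * signOp =
        L * (signOp * C * signOp) - signOp * C * signOp * L := by
      have h2 : signOp * C * (L * signOp) = signOp * C * (signOp * L) := by rw [hs]
      simp only [mul_sub, sub_mul, ← mul_assoc, hs]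
      simp only [mul_assoc] at h2 ⊢
      rw [h2]
    rw [e, e, h1, mul_smul_comm, smul_mul_assoc, ← smul_sub]
    congr 1
    noncomm_ring
  have ho : ∀ C : Op n M, oddPart (L * C - C * L) = L * oddPart C - oddPart C * L := by
    intro C
    have e : ∀ D : Op n M, oddPart D = D - evenPart D := fun D => rfl
    rw [e, e, he]
    noncomm_ring
  rw [gcomm_of_even_left hL, gcomm_of_even_left hL, gcomm_of_even_left hL]
  simp only [gcomm, he, ho]
  noncomm_ring

/-! ### Cartan calculus on differential forms -/

theorem wedgeOp_mul_fnOp (a : OneForm n M) (f : Fn n M) :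
    wedgeOp a * fnOp f = fnOp f * wedgeOp a := by
  refine Op.ext_of fun k η => ?_
  simp only [Module.End.mul_apply, fnOp_of, wedgeOp_of]
  congr 1
  ext v : 1
  simp only [Form.wedge_apply, AlternatingMap.smul_apply, smul_eq_mul, Finset.mul_sum,
    mul_left_comm, mul_smul_comm]

theorem contrOp_mul_wedgeOp (X : VF n M) (a : OneForm n M) :
    contrOp X * wedgeOp a = fnOp (a X) - wedgeOp a * contrOp X := by
  refine Op.ext_of fun k η => ?_
  cases k with
  | zero => simp [contrOp_of_zero, contrOp_of_succ, wedgeOp_of, fnOp_of, Form.contr_wedge_zero]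
  | succ k => simp [contrOp_of_succ, wedgeOp_of, fnOp_of, Form.contr_wedge]

theorem contrOp_mul_dOp (X : VF n M) : contrOp X * dOp = lieOp X - dOp * contrOp X := by
  refine Op.ext_of fun k η => ?_
  cases k with
  | zero =>
    simp only [Module.End.mul_apply, LinearMap.sub_apply, contrOp_of_zero, map_zero, sub_zero,
      dOp_of, contrOp_of_succ, lieOp_of]
    congr 1
    refine Form.ext_zero ?_
    rw [Form.extDeriv_zero, Form.contr_ofLin, Form.lieD_apply, Fin.sum_univ_zero, sub_zero]
    rfl
  | succ k => simp [contrOp_of_succ, dOp_of, lieOp_of, Form.contr_extDeriv]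

theorem contrOp_mul_lieOp (X Y : VF n M) :
    contrOp Y * lieOp X = lieOp X * contrOp Y - contrOp (X.lie Y) := by
  refine Op.ext_of fun k η => ?_
  cases k with
  | zero => simp [contrOp_of_zero, lieOp_of]
  | succ k => simp [contrOp_of_succ, lieOp_of, Form.contr_lieD]

theorem lieOp_mul_fnOp (X : VF n M) (f : Fn n M) :
    lieOp X * fnOp f = fnOp (X.act f) + fnOp f * lieOp X := by
  refine Op.ext_of fun k η => ?_
  simp [lieOp_of, fnOp_of, Form.lieD_fsmul]

theorem dOp_mul_fnOp (f : Fn n M) : dOp * fnOp f = wedgeOp f.diff + fnOp f * dOp := by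
  refine Op.ext_of fun k η => ?_
  simp only [Module.End.mul_apply, LinearMap.add_apply, dOp_of, fnOp_of, wedgeOp_of, ← map_add]
  exact congrArg _ ((extDerivStep n M k).leibniz f η)

theorem fnOp_sub (f g : Fn n M) : fnOp (f - g) = fnOp f - fnOp g := by
  refine Op.ext_of fun k η => ?_
  simp only [LinearMap.sub_apply, fnOp_of, ← map_sub]
  congr 1
  ext v : 1
  simp [sub_mul]

theorem wedgeOp_sub (a b : OneForm n M) : wedgeOp (a - b) = wedgeOp a - wedgeOp b := by
  refine Op.ext_of fun k η => ?_
  simp only [LinearMap.sub_apply, wedgeOp_of, ← map_sub]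
  congr 1
  ext v : 1
  simp [Form.wedge_apply, sub_mul, smul_sub]

/-- An operator that maps each `Ω^k` to forms of some positive degree and that commutes with all
contractions, up to a factor, vanishes: by induction on the degree, the contractions of its values
vanish. -/
theorem Op.eq_zero_of_contrOp_mul {A : Op n M}
    (hdeg : ∀ k (η : Form n M k), ∃ (m : ℕ) (θ : Form n M (m + 1)),
      A (Omega.of k η) = Omega.of (m + 1) θ)
    (c : ℝ) (hc : ∀ Y : VF n M, contrOp Y * A = c • (A * contrOp Y)) : A = 0 := by
  refine Op.ext_of fun k => ?_
  induction k with
  | zero =>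
    intro η
    obtain ⟨m, θ, hθ⟩ := hdeg 0 η
    rw [LinearMap.zero_apply, hθ, ← map_zero (Omega.of (n := n) (M := M) (m + 1))]
    congr 1
    refine Form.ext_contr fun Y => Omega.of_injective m ?_
    have := LinearMap.congr_fun (hc Y) (Omega.of 0 η)
    rw [Module.End.mul_apply, LinearMap.smul_apply, Module.End.mul_apply, contrOp_of_zero, hθ,
      contrOp_of_succ, map_zero, smul_zero] at this
    rw [this]
    exact (map_zero _).symm
  | succ k ih =>
    intro η
    obtain ⟨m, θ, hθ⟩ := hdeg (k + 1) η
    rw [LinearMap.zero_apply, hθ, ← map_zero (Omega.of (n := n) (M := M) (m + 1))]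
    congr 1
    refine Form.ext_contr fun Y => Omega.of_injective m ?_
    have := LinearMap.congr_fun (hc Y) (Omega.of (k + 1) η)
    rw [Module.End.mul_apply, LinearMap.smul_apply, Module.End.mul_apply, contrOp_of_succ, hθ,
      contrOp_of_succ, ih, LinearMap.zero_apply, smul_zero] at this
    rw [this]
    exact (map_zero _).symm

theorem wedgeOp_mul_wedgeOp (a b : OneForm n M) :
    wedgeOp a * wedgeOp b = -(wedgeOp b * wedgeOp a) := by
  rw [← add_eq_zero_iff_eq_neg]
  refine Op.eq_zero_of_contrOp_mul (fun k η => ?_) 1 fun Y => ?_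
  · simp only [LinearMap.add_apply, Module.End.mul_apply, wedgeOp_of, ← map_add]
    exact ⟨_, _, rfl⟩
  · have e : ∀ a b : OneForm n M, contrOp Y * (wedgeOp a * wedgeOp b) =
        fnOp (a Y) * wedgeOp b - fnOp (b Y) * wedgeOp a + wedgeOp a * wedgeOp b * contrOp Y := by
      intro a b
      rw [← mul_assoc, contrOp_mul_wedgeOp, sub_mul, mul_assoc, contrOp_mul_wedgeOp, mul_sub,
        wedgeOp_mul_fnOp]
      noncomm_ring
    rw [mul_add, e, e, one_smul]
    noncomm_ring

theorem lieOp_mul_wedgeOp (X : VF n M) (a : OneForm n M) :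
    lieOp X * wedgeOp a = wedgeOp a * lieOp X + wedgeOp (OneForm.lieD X a) := by
  rw [← sub_eq_zero]
  refine Op.eq_zero_of_contrOp_mul (fun k η => ?_) (-1) fun Y => ?_
  · simp only [LinearMap.add_apply, LinearMap.sub_apply, Module.End.mul_apply, wedgeOp_of,
      lieOp_of, ← map_add, ← map_sub]
    exact ⟨_, _, rfl⟩
  · have e1 : contrOp Y * (lieOp X * wedgeOp a) = fnOp (X.act (a Y)) + fnOp (a Y) * lieOp X
        - lieOp X * wedgeOp a * contrOp Y - fnOp (a (X.lie Y))
        + wedgeOp a * contrOp (X.lie Y) := by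
      rw [← mul_assoc, contrOp_mul_lieOp, sub_mul, mul_assoc, contrOp_mul_wedgeOp,
        contrOp_mul_wedgeOp, mul_sub, lieOp_mul_fnOp]
      noncomm_ring
    have e2 : contrOp Y * (wedgeOp a * lieOp X) = fnOp (a Y) * lieOp X
        - wedgeOp a * lieOp X * contrOp Y + wedgeOp a * contrOp (X.lie Y) := by
      rw [← mul_assoc, contrOp_mul_wedgeOp, sub_mul, mul_assoc, contrOp_mul_lieOp, mul_sub]
      noncomm_ring
    rw [mul_sub, mul_add, e1, e2, contrOp_mul_wedgeOp, OneForm.lieD_apply, fnOp_sub]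
    rw [neg_one_smul]
    noncomm_ring

/-- The graded commutator of `a ∧` and `d`; it is the exterior product with `da`. -/
noncomputable def dWedgeOp (a : OneForm n M) : Op n M := wedgeOp a * dOp + dOp * wedgeOp a

theorem contrOp_mul_dWedgeOp (Y : VF n M) (a : OneForm n M) :
    contrOp Y * dWedgeOp a =
      dWedgeOp a * contrOp Y + wedgeOp (OneForm.lieD Y a - (a Y).diff) := by
  have e1 : contrOp Y * (wedgeOp a * dOp) =
      fnOp (a Y) * dOp - wedgeOp a * lieOp Y + wedgeOp a * dOp * contrOp Y := by
    rw [← mul_assoc, contrOp_mul_wedgeOp, sub_mul, mul_assoc, contrOp_mul_dOp]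
    noncomm_ring
  have e2 : contrOp Y * (dOp * wedgeOp a) = wedgeOp a * lieOp Y + wedgeOp (OneForm.lieD Y a)
      - wedgeOp (a Y).diff - fnOp (a Y) * dOp + dOp * wedgeOp a * contrOp Y := by
    rw [← mul_assoc, contrOp_mul_dOp, sub_mul, mul_assoc, contrOp_mul_wedgeOp, mul_sub,
      dOp_mul_fnOp, lieOp_mul_wedgeOp]
    noncomm_ring
  rw [dWedgeOp, mul_add, e1, e2, wedgeOp_sub]
  noncomm_ring

theorem dWedgeOp_mul_fnOp (a : OneForm n M) (f : Fn n M) :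
    dWedgeOp a * fnOp f = fnOp f * dWedgeOp a := by
  have e1 : wedgeOp a * dOp * fnOp f = wedgeOp a * wedgeOp f.diff + fnOp f * (wedgeOp a * dOp) := by
    rw [mul_assoc, dOp_mul_fnOp, mul_add, ← mul_assoc (wedgeOp a), wedgeOp_mul_fnOp, mul_assoc]
  have e2 : dOp * wedgeOp a * fnOp f = wedgeOp f.diff * wedgeOp a + fnOp f * (dOp * wedgeOp a) := by
    rw [mul_assoc, wedgeOp_mul_fnOp, ← mul_assoc, dOp_mul_fnOp, add_mul, mul_assoc]
  rw [dWedgeOp, add_mul, e1, e2, wedgeOp_mul_wedgeOp]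
  noncomm_ring

theorem dWedgeOp_mul_wedgeOp (a b : OneForm n M) :
    dWedgeOp a * wedgeOp b = wedgeOp b * dWedgeOp a := by
  rw [← sub_eq_zero]
  refine Op.eq_zero_of_contrOp_mul (fun k η => ?_) (-1) fun Y => ?_
  · simp only [dWedgeOp, LinearMap.add_apply, LinearMap.sub_apply, Module.End.mul_apply,
      wedgeOp_of, dOp_of, ← map_add, ← map_sub]
    exact ⟨_, _, rfl⟩
  · have e1 : contrOp Y * (dWedgeOp a * wedgeOp b) = fnOp (b Y) * dWedgeOp a
        - dWedgeOp a * wedgeOp b * contrOp Y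
        + wedgeOp (OneForm.lieD Y a - (a Y).diff) * wedgeOp b := by
      rw [← mul_assoc, contrOp_mul_dWedgeOp, add_mul, mul_assoc, contrOp_mul_wedgeOp, mul_sub,
        dWedgeOp_mul_fnOp]
      noncomm_ring
    have e2 : contrOp Y * (wedgeOp b * dWedgeOp a) = fnOp (b Y) * dWedgeOp a
        - wedgeOp b * dWedgeOp a * contrOp Y
        + wedgeOp (OneForm.lieD Y a - (a Y).diff) * wedgeOp b := by
      rw [← mul_assoc, contrOp_mul_wedgeOp, sub_mul, mul_assoc, contrOp_mul_dWedgeOp, mul_add,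
        wedgeOp_mul_wedgeOp b]
      noncomm_ring
    rw [mul_sub, e1, e2, neg_one_smul]
    noncomm_ring

/-- The Dorfman bracket is the derived bracket of the exterior derivative. -/
theorem derivedBracket_dOp (x y : Sec n M) :
    derivedBracket dOp x.op y.op = (dorfman x y).op := by
  have hx := evenPart_eq_zero_of_anticomm (signOp_secOp x)
  have hd := evenPart_eq_zero_of_anticomm (signOp_dOp (n := n) (M := M))
  have h1 : gcomm x.op dOp = lieOp x.1 + dWedgeOp x.2 := by
    rw [gcomm_of_odd hx hd, Sec.op, add_mul, mul_add, contrOp_mul_dOp, dWedgeOp]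
    abel
  have h2 : evenPart (gcomm x.op dOp) = gcomm x.op dOp := by
    rw [evenPart_eq_self_iff, gcomm_of_odd hx hd, mul_add, add_mul, ← mul_assoc, ← mul_assoc,
      signOp_secOp, signOp_dOp, neg_mul, neg_mul, mul_assoc, mul_assoc, signOp_secOp, signOp_dOp]
    noncomm_ring
  rw [derivedBracket, gcomm_of_even_left h2, h1, dorfman_eq, Sec.op, Sec.op, mul_add, add_mul,
    add_mul, add_mul, mul_add, mul_add, contrOp_mul_lieOp, contrOp_mul_dWedgeOp,
    lieOp_mul_wedgeOp, dWedgeOp_mul_wedgeOp]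
  simp only [wedgeOp_sub]
  noncomm_ring

end

/-! ### Polynomials in a sum of two commuting elements with vanishing product -/

/-- If `a` and `b` commute and `a b v = 0`, then all mixed terms of `P(a + b) v` vanish; the
constant coefficient is counted twice in `P(a) v + P(b) v`. -/
theorem aeval_add_smul_of_smul_smul_eq_zero {R V : Type*} [Ring R] [Algebra ℝ R] [AddCommGroup V]
    [Module R V] {a b : R} (hab : Commute a b) {v : V} (hv : a • b • v = 0) (P : ℝ[X]) :
    aeval (a + b) P • v + algebraMap ℝ R (P.coeff 0) • v = aeval a P • v + aeval b P • v := by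
  induction P using Polynomial.induction_on' with
  | add P Q hP hQ =>
    simp only [map_add, coeff_add, add_smul]
    rw [add_add_add_comm, hP, hQ, add_add_add_comm]
  | monomial k c =>
    have key : ∀ j : ℕ, (a + b) ^ (j + 1) • v = a ^ (j + 1) • v + b ^ (j + 1) • v := by
      have hba : b • a • v = 0 := by rw [smul_smul, ← hab.eq, ← smul_smul, hv]
      have h1 : ∀ j : ℕ, a • b ^ (j + 1) • v = 0 := fun j => by
        rw [smul_smul, pow_succ, ← mul_assoc, (hab.pow_right j).eq, mul_assoc, ← smul_smul,
          ← smul_smul, hv, smul_zero]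
      have h2 : ∀ j : ℕ, b • a ^ (j + 1) • v = 0 := fun j => by
        rw [smul_smul, pow_succ, ← mul_assoc, (hab.symm.pow_right j).eq, mul_assoc, ← smul_smul,
          ← smul_smul, hba, smul_zero]
      intro j
      induction j with
      | zero => simp [add_smul]
      | succ j ih =>
        rw [pow_succ', mul_smul, ih, smul_add, add_smul, add_smul, h1, h2, pow_succ' a (j + 1),
          pow_succ' b (j + 1), mul_smul, mul_smul, add_zero, zero_add]
    cases k with
    | zero => simp
    | succ k =>
      rw [aeval_monomial, aeval_monomial, aeval_monomial, mul_smul, mul_smul, mul_smul, key,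
        coeff_monomial, if_neg (Nat.succ_ne_zero k), map_zero, zero_smul, add_zero, smul_add]

theorem aeval_add_of_mul_eq_zero {R : Type*} [Ring R] [Algebra ℝ R] {a b : R} (hab : Commute a b)
    (h : a * b = 0) (P : ℝ[X]) :
    aeval (a + b) P + algebraMap ℝ R (P.coeff 0) = aeval a P + aeval b P := by
  simpa using aeval_add_smul_of_smul_smul_eq_zero hab (v := (1 : R)) (by simpa using h) P

theorem aeval_add_apply_of_apply_apply_eq_zero {V : Type*} [AddCommGroup V] [Module ℝ V]
    {f g : Module.End ℝ V} (hfg : Commute f g) {v : V} (hv : f (g v) = 0) (P : ℝ[X]) :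
    aeval (f + g) P v + P.coeff 0 • v = aeval f P v + aeval g P v :=
  aeval_add_smul_of_smul_smul_eq_zero hfg hv P

/-- A linear relation between two vector spaces that is preserved by a pair of endomorphisms
`(f, g)` is preserved by `(P(f), P(g))`. -/
theorem aeval_apply_rel {V W : Type*} [AddCommGroup V] [Module ℝ V] [AddCommGroup W] [Module ℝ W]
    {r : V → W → Prop} (hadd : ∀ {v v' w w'}, r v w → r v' w' → r (v + v') (w + w'))
    (hsmul : ∀ (c : ℝ) {v w}, r v w → r (c • v) (c • w)) {f : Module.End ℝ V}
    {g : Module.End ℝ W} (hfg : ∀ {v w}, r v w → r (f v) (g w)) {v : V} {w : W} (h : r v w)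
    (P : ℝ[X]) : r (aeval f P v) (aeval g P w) := by
  induction P using Polynomial.induction_on' with
  | add P Q hP hQ =>
    rw [map_add, map_add]
    exact hadd hP hQ
  | monomial k c =>
    simp only [aeval_monomial, Algebra.algebraMap_eq_smul_one, smul_mul_assoc, one_mul,
      LinearMap.smul_apply]
    refine hsmul c ?_
    induction k with
    | zero => exact h
    | succ j ih =>
      rw [pow_succ', pow_succ']
      exact hfg ih

section
variable {n : ℕ} {M : Type*} [TopologicalSpace M] [ChartedSpace (Model n) M]
  [IsManifold (𝓡 n) ∞ M]

theorem IsMinimalPolynomial.dvd {φ : Module.End (Fn n M) (Sec n M)} {P Q : ℝ[X]}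
    (hP : IsMinimalPolynomial φ P) (hQ : aeval φ Q = 0) : P ∣ Q := by
  obtain ⟨hmonic, h0, hmin⟩ := hP
  rw [← modByMonic_eq_zero_iff_dvd hmonic]
  by_contra hR
  have hR0 : aeval φ (Q %ₘ P) = 0 := by
    rw [modByMonic_eq_sub_mul_div Q P, map_sub, map_mul, hQ, h0, zero_mul, sub_zero]
  have h1 := hmin _ (monic_mul_leadingCoeff_inv hR) (by rw [map_mul, hR0, zero_mul])
  rw [natDegree_mul_leadingCoeff_inv _ hR] at h1
  have h2 := degree_modByMonic_lt Q hmonic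
  exact absurd (natDegree_lt_natDegree hR h2) (not_lt.2 h1)

/-! ### The Dorfman bracket as a biadditive map -/

theorem VF.add_lie (X Y Z : VF n M) : (X + Y).lie Z = X.lie Z + Y.lie Z := by
  rw [VF.lie_swap, VF.lie_add, VF.lie_swap Z X, VF.lie_swap Z Y]
  abel

theorem dorfman_add (x y z : Sec n M) : dorfman x (y + z) = dorfman x y + dorfman x z := by
  simp only [dorfman_eq]
  refine Prod.ext (VF.lie_add _ _ _) (LinearMap.ext fun Z => ?_)
  simp only [Prod.fst_add, Prod.snd_add, LinearMap.add_apply, LinearMap.sub_apply,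
    OneForm.lieD_apply, Fn.diff_apply, VF.act_add, VF.add_act, VF.add_lie, map_add]
  ring

theorem add_dorfman (x y z : Sec n M) : dorfman (x + y) z = dorfman x z + dorfman y z := by
  simp only [dorfman_eq]
  refine Prod.ext (VF.add_lie _ _ _) (LinearMap.ext fun Z => ?_)
  simp only [Prod.fst_add, Prod.snd_add, LinearMap.add_apply, LinearMap.sub_apply,
    OneForm.lieD_apply, Fn.diff_apply, VF.act_add, VF.add_act, VF.add_lie, map_add]
  ring

/-- The Dorfman bracket as a biadditive map. -/
noncomputable def dorfmanHom : Sec n M →+ Sec n M →+ Sec n M :=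
  AddMonoidHom.mk' (fun x => AddMonoidHom.mk' (dorfman x) (dorfman_add x)) fun x y => by
    ext1 z
    exact add_dorfman x y z

@[simp] theorem dorfmanHom_apply (x y : Sec n M) : dorfmanHom x y = dorfman x y := rfl

/-- The action of `φ` on biadditive maps by
`b ↦ ((x, y) ↦ φ (b(x, y)) - b(φ x, y) - b(x, φ y))`. -/
noncomputable def bracketAction (φ : Module.End (Fn n M) (Sec n M)) :
    Module.End ℝ (Sec n M →+ Sec n M →+ Sec n M) where
  toFun b := AddMonoidHom.mk' (fun x => AddMonoidHom.mk'
      (fun y => φ (b x y) - b (φ x) y - b x (φ y)) fun y z => by simp only [map_add]; abel)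
    fun x y => by
      ext1 z
      simp only [map_add, AddMonoidHom.mk'_apply, AddMonoidHom.add_apply]
      abel
  map_add' b c := by
    ext1 x; ext1 y
    simp only [map_add, AddMonoidHom.mk'_apply, AddMonoidHom.add_apply]
    abel
  map_smul' r b := by
    ext1 x; ext1 y
    simp only [AddMonoidHom.mk'_apply, AddMonoidHom.smul_apply, RingHom.id_apply, smul_sub,
      LinearMap.map_smul_of_tower]

theorem bracketAction_apply (φ : Module.End (Fn n M) (Sec n M))
    (b : Sec n M →+ Sec n M →+ Sec n M) (x y : Sec n M) :
    bracketAction φ b x y = φ (b x y) - b (φ x) y - b x (φ y) := rfl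

theorem bracketAction_add (φ ψ : Module.End (Fn n M) (Sec n M)) :
    bracketAction (φ + ψ) = bracketAction φ + bracketAction ψ := by
  refine LinearMap.ext fun b => ?_
  ext1 x; ext1 y
  simp only [bracketAction_apply, LinearMap.add_apply, AddMonoidHom.add_apply, map_add]
  abel

theorem commute_bracketAction {φ ψ : Module.End (Fn n M) (Sec n M)} (h : Commute φ ψ) :
    Commute (bracketAction φ) (bracketAction ψ) := by
  have h' : ∀ x, φ (ψ x) = ψ (φ x) := fun x => LinearMap.congr_fun h.eq x
  refine LinearMap.ext fun b => ?_
  ext1 x; ext1 y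
  simp only [Module.End.mul_apply, bracketAction_apply, map_sub, h']
  abel

/-- When the products of the two endomorphisms vanish, the bivariate torsion is what the
successive action of both of them on the Dorfman bracket gives. -/
theorem bracketAction_bracketAction_dorfmanHom {φ ψ : Module.End (Fn n M) (Sec n M)}
    (h1 : φ * ψ = 0) (h2 : ψ * φ = 0) (x y : Sec n M) :
    bracketAction φ (bracketAction ψ dorfmanHom) x y = bivariateTorsion φ ψ x y := by
  have h1' : ∀ x, φ (ψ x) = 0 := fun x => LinearMap.congr_fun h1 x
  have h2' : ∀ x, ψ (φ x) = 0 := fun x => LinearMap.congr_fun h2 x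
  have e1 : ∀ x, dorfman x (0 : Sec n M) = 0 := fun x => map_zero (dorfmanHom x)
  have e2 : ∀ x, dorfman (0 : Sec n M) x = 0 := fun x =>
    DFunLike.congr_fun (map_zero (dorfmanHom (n := n) (M := M))) x
  simp only [bracketAction_apply, dorfmanHom_apply, bivariateTorsion, torsion, LinearMap.add_apply,
    map_add, map_sub, dorfman_add, add_dorfman, h1', h2', e1, e2]
  abel

/-! ### Derived brackets of the operators `P(ad_L)(d)` -/

theorem Sec.op_add (x y : Sec n M) : (x + y).op = x.op + y.op := by
  refine Op.ext_of fun k η => ?_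
  have hw : Form.wedge (x.2 + y.2) η = Form.wedge x.2 η + Form.wedge y.2 η := by
    ext v : 1
    simp only [Form.wedge_apply, AlternatingMap.add_apply, LinearMap.add_apply, add_mul, smul_add,
      Finset.sum_add_distrib]
  cases k with
  | zero =>
    simp only [Sec.op, LinearMap.add_apply, contrOp_of_zero, wedgeOp_of, Prod.snd_add, hw, map_add]
    abel
  | succ k =>
    simp only [Sec.op, LinearMap.add_apply, contrOp_of_succ, wedgeOp_of, Prod.snd_add, hw, map_add,
      Prod.fst_add, Form.add_contr]
    abel

theorem Sec.op_smul (c : ℝ) (x : Sec n M) : (c • x).op = c • x.op := by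
  refine Op.ext_of fun k η => ?_
  have hw : Form.wedge (c • x.2) η = c • Form.wedge x.2 η := by
    ext v : 1
    simp only [Form.wedge_apply, AlternatingMap.smul_apply, LinearMap.smul_apply, smul_mul_assoc,
      Finset.smul_sum, smul_comm c]
  cases k with
  | zero =>
    simp only [Sec.op, LinearMap.add_apply, LinearMap.smul_apply, contrOp_of_zero, wedgeOp_of,
      Prod.smul_snd, hw, map_smul, smul_add, smul_zero]
  | succ k =>
    have hc : Form.contr (c • x.1) η = c • Form.contr x.1 η := by
      rw [← algebraMap_smul (Fn n M) c x.1, Form.smul_contr]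
      ext v : 1
      exact algebraMap_smul (Fn n M) c (Form.contr x.1 η v)
    simp only [Sec.op, LinearMap.add_apply, LinearMap.smul_apply, contrOp_of_succ, wedgeOp_of,
      Prod.smul_snd, Prod.smul_fst, hw, hc, map_smul, smul_add]

/-- The inclusion of the sections of `𝕋M` in the operators on forms. -/
noncomputable def Sec.opLin : Sec n M →ₗ[ℝ] Op n M where
  toFun x := x.op
  map_add' := Sec.op_add
  map_smul' := Sec.op_smul

theorem Sec.opLin_apply (x : Sec n M) : Sec.opLin x = x.op := rfl

/-- `b` represents the derived bracket of `δ` on the sections of `𝕋M`. -/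
def Represents (δ : Op n M) (b : Sec n M →+ Sec n M →+ Sec n M) : Prop :=
  ∀ x y : Sec n M, derivedBracket δ x.op y.op = (b x y).op

theorem represents_dOp : Represents (n := n) (M := M) dOp dorfmanHom := derivedBracket_dOp

theorem derivedBracket_add (δ ε A B : Op n M) :
    derivedBracket (δ + ε) A B = derivedBracket δ A B + derivedBracket ε A B := by
  simp only [derivedBracket, gcomm, map_add, map_sub, mul_add, add_mul, mul_sub, sub_mul]
  abel

theorem derivedBracket_smul (c : ℝ) (δ A B : Op n M) :
    derivedBracket (c • δ) A B = c • derivedBracket δ A B := by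
  simp only [derivedBracket, gcomm, map_add, map_sub, map_smul, smul_add, smul_sub, mul_add,
    add_mul, mul_sub, sub_mul, smul_mul_assoc, mul_smul_comm]

/-- As `ad_L` is a derivation of the graded commutator, the derived bracket of `ad_L δ` arises from
that of `δ` by the action of `φ`. -/
theorem Represents.ad {φ : Module.End (Fn n M) (Sec n M)} {L : Op n M} (hL : IsLift φ L)
    {δ : Op n M} {b : Sec n M →+ Sec n M →+ Sec n M} (h : Represents δ b) :
    Represents (adOp L δ) (bracketAction φ b) := by
  intro x y
  have h1 := gcomm_gcomm_of_even hL.even (gcomm x.op δ) y.op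
  rw [gcomm_gcomm_of_even hL.even x.op δ, hL.sec, hL.sec] at h1
  have hadd : ∀ A B C : Op n M, gcomm (A + B) C = gcomm A C + gcomm B C := by
    intro A B C
    simp only [gcomm, map_add, mul_add, add_mul]
    abel
  rw [hadd] at h1
  have e1 : gcomm (gcomm x.op δ) y.op = (b x y).op := h x y
  have e2 : gcomm (gcomm (φ x).op δ) y.op = (b (φ x) y).op := h _ _
  have e3 : gcomm (gcomm x.op δ) (φ y).op = (b x (φ y)).op := h _ _
  rw [e1, e2, e3, hL.sec] at h1
  change gcomm (gcomm x.op (gcomm L δ)) y.op = _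
  simp only [bracketAction_apply, ← Sec.opLin_apply, map_sub] at h1 ⊢
  rw [h1]
  abel

theorem Represents.aeval_ad {φ : Module.End (Fn n M) (Sec n M)} {L : Op n M} (hL : IsLift φ L)
    {δ : Op n M} {b : Sec n M →+ Sec n M →+ Sec n M} (h : Represents δ b) (P : ℝ[X]) :
    Represents (aeval (adOp L) P δ) (aeval (bracketAction φ) P b) := by
  refine aeval_apply_rel (r := Represents) (fun h h' x y => ?_) (fun c _ _ h x y => ?_)
    (fun h => h.ad hL) h P
  · rw [derivedBracket_add, h x y, h' x y, ← Sec.op_add]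
    rfl
  · rw [derivedBracket_smul, h x y, ← Sec.op_smul]
    rfl

theorem represents_minimalOp {φ : Module.End (Fn n M) (Sec n M)} {L : Op n M} (hL : IsLift φ L)
    (P : ℝ[X]) : Represents (minimalOp L P) (aeval (bracketAction φ) P dorfmanHom) :=
  represents_dOp.aeval_ad hL P

/-- If `φ` is minimal, then `P(ad_L)(d)` has vanishing derived bracket for every polynomial `P` that
annihilates `φ`, as `P` is a multiple of the minimal polynomial. -/
theorem IsMinimal.exists_isLift {φ : Module.End (Fn n M) (Sec n M)} (h : IsMinimal φ) {P : ℝ[X]}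
    (hP : aeval φ P = 0) : ∃ L : Op n M, IsLift φ L ∧
      ∀ x y, (aeval (bracketAction φ) P dorfmanHom x y).op = 0 := by
  obtain ⟨Q, L, hQ, hL, h0⟩ := h
  obtain ⟨R, rfl⟩ := hQ.dvd hP
  refine ⟨L, hL, fun x y => ?_⟩
  have hz : Represents (minimalOp L Q) 0 := fun x y => (h0 x y).trans (map_zero Sec.opLin).symm
  have hR := hz.aeval_ad hL R x y
  rw [map_zero] at hR
  rw [← represents_minimalOp hL (Q * R) x y, minimalOp, mul_comm, map_mul, Module.End.mul_apply]
  exact hR.trans (map_zero Sec.opLin)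

theorem IsLift.add {φ ψ : Module.End (Fn n M) (Sec n M)} {L K : Op n M} (hL : IsLift φ L)
    (hK : IsLift ψ K) : IsLift (φ + ψ) (L + K) := by
  have hadd : ∀ C : Op n M, gcomm (L + K) C = gcomm L C + gcomm K C := by
    intro C
    simp only [gcomm, map_add, mul_add, add_mul]
    abel
  refine ⟨by rw [map_add, hL.even, hK.even], fun f => ?_, fun x => ?_, ?_⟩
  · rw [hadd, hL.fn, hK.fn, add_zero]
  · rw [hadd, hL.sec, hK.sec, ← Sec.op_add, LinearMap.add_apply]
  · obtain ⟨η, hη⟩ := hL.one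
    obtain ⟨θ, hθ⟩ := hK.one
    exact ⟨η + θ, by rw [LinearMap.add_apply, hη, hθ, map_add]⟩

end
end GenPoly

theorem mainTheorem8 {n : ℕ} {M : Type*} [TopologicalSpace M] [T2Space M]
    [SecondCountableTopology M] [ChartedSpace (EuclideanSpace ℝ (Fin n)) M]
    [IsManifold (𝓡 n) ∞ M] (φ' φ'' : Module.End (Fn n M) (Sec n M))
    (h' : IsGPS φ') (h'' : IsGPS φ'') (h1 : φ' * φ'' = 0) (h2 : φ'' * φ' = 0)
    (hm' : IsMinimal φ') (hm'' : IsMinimal φ'')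
    (P : ℝ[X]) (hP : IsMinimalPolynomial (φ' + φ'') P) (hP' : aeval φ' P = 0)
    (hP'' : aeval φ'' P = 0) (hb : ∀ x y, bivariateTorsion φ' φ'' x y = 0) :
    IsMinimal (φ' + φ'') := by
  obtain ⟨L', hL', z'⟩ := hm'.exists_isLift hP'
  obtain ⟨L'', hL'', z''⟩ := hm''.exists_isLift hP''
  have hcomm : Commute φ' φ'' := h1.trans h2.symm
  -- The constant coefficient of `P` annihilates all sections, because
  -- `P(φ' + φ'') + P(0) = P(φ') + P(φ'')`.
  have hconst : ∀ s : Sec n M, P.coeff 0 • s = 0 := fun s => by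
    have h3 := aeval_add_of_mul_eq_zero hcomm h1 P
    rw [hP.2.1, hP', hP'', zero_add, add_zero, Algebra.algebraMap_eq_smul_one] at h3
    exact LinearMap.congr_fun h3 s
  have hbr : bracketAction φ' (bracketAction φ'' dorfmanHom) = 0 := by
    refine AddMonoidHom.ext fun x => AddMonoidHom.ext fun y => ?_
    exact (bracketAction_bracketAction_dorfmanHom h1 h2 x y).trans (hb x y)
  have key := aeval_add_apply_of_apply_apply_eq_zero (commute_bracketAction hcomm) hbr P
  refine ⟨P, L' + L'', hP, hL'.add hL'', fun x y => ?_⟩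
  have h4 := congrArg Sec.opLin (DFunLike.congr_fun (DFunLike.congr_fun key x) y)
  simp only [AddMonoidHom.add_apply, AddMonoidHom.smul_apply, hconst, add_zero, map_add,
    Sec.opLin_apply, z', z''] at h4
  rw [represents_minimalOp (hL'.add hL'') P x y, bracketAction_add, h4]
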